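/- Let $n\ge 1$ and let $S^{n-1}$ be the unit sphere of $\mathbb{R}^n$, with spherical Lebesgue measure $du=d\mathcal{H}^{n-1}(u)$. For a convex body $K\subset\mathbb{R}^n$ containing the origin in its interior let $h_K(u)=\sup_{x\in K}\langle u,x\rangle$ and $\rho_K(u)=\sup\{\lambda>0:\lambda u\in K\}$, $u\in S^{n-1}$, be its support and radial functions. For almost all $u\in S^{n-1}$, let $\alpha_K(u)$ be the unique outer unit normal vector of $K$ at $\rho_K(u)u\in\partial K$. For $E\subset S^{n-1}$ let $\boldsymbol{\alpha}^*_K(E)=\{x/|x|: x\in\partial K,\ \langle x,v\rangle=h_K(v)\text{ for some }v\in E\}$. For $G:(0,\infty)\times S^{n-1}\to\mathbb{R}$ with partial derivative $G_t(t,u)=\partial G(t,u)/\partial t$, and $\psi:(0,\infty)\to\mathbb{R}\setminus\{0\}$ continuous, the general dual volume and the general dual Orlicz curvature measure of $K$ are $$\widetilde V_G(K)=\int_{S^{n-1}}G(\rho_K(u),u)\,du,\qquad \widetilde C_{G,\psi}(K,E)=\frac1n\int_{\boldsymbol{\alpha}^*_K(E)}\frac{\rho_K(u)\,G_t(\rho_K(u),u)}{\psi(h_K(\alpha_K(u)))}\,du\quad(E\subset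 S^{n-1}\text{ Borel}).$$ For $a\in\mathbb{R}\cup\{-\infty\}$ let $\mathcal{J}_a$ be the class of continuous, strictly monotonic functions $\varphi:(0,\infty)\to(a,\infty)$ with $\inf_{t>0}\varphi(t)=a$ and $\sup_{t>0}\varphi(t)=\infty$. For a closed set $\Omega\subset S^{n-1}$ not contained in any closed hemisphere of $S^{n-1}$ and a continuous $f:\Omega\to(0,\infty)$ let $[f]=\bigcap_{u\in\Omega}\{x\in\mathbb{R}^n:\langle x,u\rangle\le f(u)\}$ be its Aleksandrov body. **Theorem.** Let $\Omega\subset S^{n-1}$ be a closed set not contained in any closed hemisphere, let $g:\Omega\to\mathbb{R}$ and $h_0:\Omega\to(0,\infty)$ be continuous, and let $a\in\mathbb{R}\cup\{-\infty\}$. Suppose that $\varphi\in\mathcal{J}_a$ is continuously differentiable with $\varphi'\ne0$ on $(0,\infty)$, and put $\psi(t)=t\varphi'(t)$. For $\varepsilon$ close to $0$ let $h_\varepsilon(u)=\varphi^{-1}\big(\varphi(h_0(u))+\varepsilon g(u)\big)$, $u\in\Omega$. If $G:(0,\infty)\times S^{n-1}\to\mathbb{R}$ is continuous and $G_t$ exists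 and is continuous on $(0,\infty)\times S^{n-1}$, then, for all $\varepsilon$ close to $0$, $h_\varepsilon$ is well defined on $\Omega$ and $u\mapsto G(\rho_{[h_\varepsilon]}(u),u)$ is integrable on $S^{n-1}$; the integrand defining $\widetilde C_{G,\psi}([h_0],\cdot)$ is integrable on $S^{n-1}$, the sets $\boldsymbol{\alpha}^*_{[h_0]}(E)$ with $E\subset S^{n-1}$ Borel are measurable with respect to (the completion of) $du$, and $\widetilde C_{G,\psi}([h_0],\cdot)$ is a finite signed Borel measure on $S^{n-1}$ with respect to which $g$ is integrable on $\Omega$; and $$\lim_{\varepsilon\to0}\frac{\widetilde V_G([h_\varepsilon])-\widetilde V_G([h_0])}{\varepsilon}=n\int_\Omega g(u)\,d\widetilde C_{G,\psi}([h_0],u).$$ -/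

import Mathlib

open MeasureTheory Set Filter Topology

noncomputable section

namespace DualOrlicz

/-- The unit sphere `S^{n-1}` of `ℝⁿ`, as a type. -/
abbrev Sphere (n : ℕ) : Type := Metric.sphere (0 : EuclideanSpace ℝ (Fin n)) 1

/-- The spherical Lebesgue measure `du = dℋ^{n-1}(u)` on `S^{n-1}`, normalized so that the total
mass is `n` times the volume of the unit ball. -/
def sphereMeasure (n : ℕ) : Measure (Sphere n) :=
  (volume : Measure (EuclideanSpace ℝ (Fin n))).toSphere

/-- The closed hemisphere of `S^{n-1}` centred at `v`. -/
def closedHemisphere {n : ℕ} (v : Sphere n) : Set (Sphere n) :=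
  {u | 0 ≤ inner ℝ (u : EuclideanSpace ℝ (Fin n)) v}

/-- The class `𝒥_a`, `a ∈ ℝ ∪ {-∞}`, of continuous strictly monotonic functions on `(0, ∞)` with
infimum `a` and supremum `∞` (both computed in the extended reals). As `φ` is strictly monotonic,
the infimum is not attained, so that `φ` takes its values in `(a, ∞)`. Only the restriction of
`φ` to `(0, ∞)` matters. -/
structure ClassJ (a : EReal) (φ : ℝ → ℝ) : Prop where
  ne_top : a ≠ ⊤
  continuousOn : ContinuousOn φ (Ioi 0)
  strictMono_or_strictAnti : StrictMonoOn φ (Ioi 0) ∨ StrictAntiOn φ (Ioi 0)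
  iInf_eq : ⨅ t : Ioi (0 : ℝ), ((φ t : ℝ) : EReal) = a
  iSup_eq : ⨆ t : Ioi (0 : ℝ), ((φ t : ℝ) : EReal) = ⊤

/-- `f_ε(u) = φ⁻¹(φ(f₀(u)) + ε g(u))`, where `φ⁻¹` is the inverse of `φ` on `(0, ∞)`. -/
def orliczPerturbation {n : ℕ} (φ : ℝ → ℝ) (f₀ g : Sphere n → ℝ) (ε : ℝ) (u : Sphere n) : ℝ :=
  Function.invFunOn φ (Ioi 0) (φ (f₀ u) + ε * g u)

/-- The Aleksandrov body (Wulff shape) `[f] = ⋂_{u ∈ Ω} {x | ⟨x, u⟩ ≤ f(u)}`. -/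
def aleksandrovBody {n : ℕ} (Ω : Set (Sphere n)) (f : Sphere n → ℝ) :
    Set (EuclideanSpace ℝ (Fin n)) :=
  ⋂ u ∈ Ω, {x | inner ℝ x (u : EuclideanSpace ℝ (Fin n)) ≤ f u}

/-- The support function `h_K(u) = sup_{x ∈ K} ⟨u, x⟩`. -/
def supportFn {n : ℕ} (K : Set (EuclideanSpace ℝ (Fin n))) (u : Sphere n) : ℝ :=
  sSup ((fun x => inner ℝ (u : EuclideanSpace ℝ (Fin n)) x) '' K)

/-- The radial function `ρ_K(u) = sup {λ > 0 | λ u ∈ K}`. -/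
def radialFn {n : ℕ} (K : Set (EuclideanSpace ℝ (Fin n))) (u : Sphere n) : ℝ :=
  sSup {r : ℝ | 0 < r ∧ r • (u : EuclideanSpace ℝ (Fin n)) ∈ K}

/-- The supporting hyperplane `H(K, u) = {x | ⟨x, u⟩ = h_K(u)}`. -/
def supportHyperplane {n : ℕ} (K : Set (EuclideanSpace ℝ (Fin n))) (u : Sphere n) :
    Set (EuclideanSpace ℝ (Fin n)) :=
  {x | inner ℝ x (u : EuclideanSpace ℝ (Fin n)) = supportFn K u}

/-- The spherical image `𝛎_K(B)` of a set `B` of boundary points. -/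
def sphericalImage {n : ℕ} (K B : Set (EuclideanSpace ℝ (Fin n))) : Set (Sphere n) :=
  {v | ∃ x ∈ B, x ∈ supportHyperplane K v}

/-- The reverse spherical image `𝐱_K(E)` of a set `E` of directions. -/
def reverseSphericalImage {n : ℕ} (K : Set (EuclideanSpace ℝ (Fin n))) (E : Set (Sphere n)) :
    Set (EuclideanSpace ℝ (Fin n)) :=
  {x | x ∈ frontier K ∧ ∃ v ∈ E, x ∈ supportHyperplane K v}

/-- The radial Gauss image `𝛂_K(E) = 𝛎_K({ρ_K(u) u ∈ ∂K | u ∈ E})`. -/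
def radialGaussImage {n : ℕ} (K : Set (EuclideanSpace ℝ (Fin n))) (E : Set (Sphere n)) :
    Set (Sphere n) :=
  sphericalImage K
    {x | x ∈ frontier K ∧ ∃ u ∈ E, x = radialFn K u • (u : EuclideanSpace ℝ (Fin n))}

/-- The reverse radial Gauss image `𝛂*_K(E) = {x / |x| | x ∈ 𝐱_K(E)}`. -/
def reverseRadialGaussImage {n : ℕ} (K : Set (EuclideanSpace ℝ (Fin n))) (E : Set (Sphere n)) :
    Set (Sphere n) :=
  {u | ∃ x ∈ reverseSphericalImage K E, (u : EuclideanSpace ℝ (Fin n)) = ‖x‖⁻¹ • x}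

open Classical in
/-- The radial Gauss map `α_K`: `α_K(u)` is the element of `𝛂_K({u})`. For a convex body containing
the origin in its interior that set is a singleton for almost all `u`; on the exceptional null set
some element is chosen. -/
def radialGaussMap {n : ℕ} (K : Set (EuclideanSpace ℝ (Fin n))) (u : Sphere n) : Sphere n :=
  if h : (radialGaussImage K {u}).Nonempty then h.choose else u

/-- The general dual volume `Ṽ_G(K) = ∫_{S^{n-1}} G(ρ_K(u), u) du`. -/
def generalDualVolume {n : ℕ} (G : ℝ → Sphere n → ℝ) (K : Set (EuclideanSpace ℝ (Fin n))) : ℝ :=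
  ∫ u, G (radialFn K u) u ∂(sphereMeasure n)

/-- The partial derivative `G_t(t, u) = ∂G(t, u)/∂t`. -/
def partialT {n : ℕ} (G : ℝ → Sphere n → ℝ) (t : ℝ) (u : Sphere n) : ℝ :=
  deriv (fun s => G s u) t

/-- The integrand `ρ_K(u) G_t(ρ_K(u), u) / ψ(h_K(α_K(u)))` of the general dual Orlicz curvature
measure. -/
def curvatureIntegrand {n : ℕ} (G : ℝ → Sphere n → ℝ) (ψ : ℝ → ℝ)
    (K : Set (EuclideanSpace ℝ (Fin n))) (u : Sphere n) : ℝ :=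
  radialFn K u * partialT G (radialFn K u) u / ψ (supportFn K (radialGaussMap K u))

/-- `μ` is the general dual Orlicz curvature measure of `K`, that is,
`μ(E) = (1/n) ∫_{𝛂*_K(E)} ρ_K(u) G_t(ρ_K(u), u) / ψ(h_K(α_K(u))) du` for every Borel set
`E ⊆ S^{n-1}`, where the integrals make sense. There is at most one such signed measure. -/
structure IsDualOrliczCurvatureMeasure {n : ℕ} (G : ℝ → Sphere n → ℝ) (ψ : ℝ → ℝ)
    (K : Set (EuclideanSpace ℝ (Fin n))) (μ : SignedMeasure (Sphere n)) : Prop where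
  integrable : Integrable (curvatureIntegrand G ψ K) (sphereMeasure n)
  nullMeasurableSet : ∀ E : Set (Sphere n), MeasurableSet E →
    NullMeasurableSet (reverseRadialGaussImage K E) (sphereMeasure n)
  apply_eq : ∀ E : Set (Sphere n), MeasurableSet E →
    μ E = (1 / (n : ℝ)) *
      ∫ u in reverseRadialGaussImage K E, curvatureIntegrand G ψ K u ∂(sphereMeasure n)

open Classical in
/-- The general dual Orlicz curvature measure `C̃_{G,ψ}(K, ·)`, a finite signed Borel measure on
`S^{n-1}` (with the value `0` where its defining formula does not give a signed measure). -/
def dualOrliczCurvatureMeasure {n : ℕ} (G : ℝ → Sphere n → ℝ) (ψ : ℝ → ℝ)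
    (K : Set (EuclideanSpace ℝ (Fin n))) : SignedMeasure (Sphere n) :=
  if h : ∃ μ, IsDualOrliczCurvatureMeasure G ψ K μ then h.choose else 0

end DualOrlicz

end

/-!
The Minkowski functional of `[f]` at `u` is `1 / ρ_{[f]}(u) = max_{v ∈ Ω} ⟨u, v⟩ / f(v)`. Every
maximizer `v` is an outer unit normal of `[f]` at `ρ_{[f]}(u) u` and satisfies `h_{[f]}(v) = f(v)`;
wherever the Minkowski functional is differentiable, which is almost everywhere because it is
Lipschitz, its gradient is a multiple of every such normal, so that the maximizer is unique and
equals `α_{[f]}(u)`.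

As `1 / h_ε` is differentiable at `ε = 0` uniformly on `Ω`, Danskin's envelope theorem says that for
almost all `u` the derivative of `1 / ρ_{[h_ε]}(u)` at `ε = 0` is obtained by differentiating
`⟨u, v⟩ / h_ε(v)` at the fixed direction `v = α_{[h₀]}(u)`. The chain rule gives the derivative of
`G(ρ_{[h_ε]}(u), u)`, and dominated convergence, with a Lipschitz bound that is uniform in `u`,
allows one to integrate it over the sphere. Up to null sets `𝛂*_K(E)` is the preimage of `E` under
`α_K`, so `C̃_{G,ψ}(K, ·)` is the push-forward under `α_K` of a signed measure with density, and the
integral of the derivative becomes the integral of `g` against it.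
-/

namespace DualOrlicz

/-! ### Maxima of uniformly differentiable families -/

lemma eventually_forall_mem_of_nhdsWithin {X Y : Type*} [TopologicalSpace X] [TopologicalSpace Y]
    {x₀ : X} {K : Set Y} (hK : IsCompact K) {P : X → Y → Prop}
    (hP : ∀ y ∈ K, ∀ᶠ z : X × Y in 𝓝 x₀ ×ˢ 𝓝[K] y, P z.1 z.2) :
    ∀ᶠ x in 𝓝 x₀, ∀ y ∈ K, P x y := by
  have hlocal : ∀ y ∈ K, ∀ᶠ z : X × Y in 𝓝 (x₀, y), z.2 ∈ K → P z.1 z.2 := by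
    intro y hy
    have := hP y hy
    rw [← nhdsWithin_univ x₀, ← nhdsWithin_prod_eq, eventually_nhdsWithin_iff] at this
    exact this.mono fun z hz hzK => hz ⟨mem_univ _, hzK⟩
  exact (hK.eventually_forall_of_forall_eventually (P := fun x y => y ∈ K → P x y) hlocal).mono
    fun x hx y hy => hx y hy hy

section UniformDerivative

variable {X : Type*} {F : ℝ → X → ℝ} {p : X → ℝ} {s : Set X} {t₀ : ℝ}

/-- `p x` is the derivative of `t ↦ F t x` at `t₀`, uniformly in `x ∈ s`. -/
def HasUniformDerivAt (F : ℝ → X → ℝ) (p : X → ℝ) (s : Set X) (t₀ : ℝ) : Prop :=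
  (fun z : ℝ × X => F z.1 z.2 - F t₀ z.2 - (z.1 - t₀) * p z.2) =o[𝓝 t₀ ×ˢ 𝓟 s] fun z => z.1 - t₀

lemma hasUniformDerivAt_iff : HasUniformDerivAt F p s t₀ ↔ ∀ c > 0, ∀ᶠ t in 𝓝 t₀, ∀ x ∈ s,
    |F t x - F t₀ x - (t - t₀) * p x| ≤ c * |t - t₀| := by
  simp only [HasUniformDerivAt, Asymptotics.isLittleO_iff, eventually_prod_principal_iff,
    Real.norm_eq_abs, gt_iff_lt]

lemma hasUniformDerivAt_of_forall_nhdsWithin [TopologicalSpace X] (hs : IsCompact s)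
    (h : ∀ x ∈ s, (fun z : ℝ × X => F z.1 z.2 - F t₀ z.2 - (z.1 - t₀) * p z.2)
      =o[𝓝 t₀ ×ˢ 𝓝[s] x] fun z => z.1 - t₀) : HasUniformDerivAt F p s t₀ := by
  rw [hasUniformDerivAt_iff]
  exact fun c hc => eventually_forall_mem_of_nhdsWithin hs fun x hx => (h x hx).bound hc

lemma HasUniformDerivAt.bdd_mul (h : HasUniformDerivAt F p s t₀) {b : X → ℝ} {B : ℝ}
    (hb : ∀ x ∈ s, |b x| ≤ B) :
    HasUniformDerivAt (fun t x => b x * F t x) (fun x => b x * p x) s t₀ := by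
  have hbO : (fun z : ℝ × X => b z.2) =O[𝓝 t₀ ×ˢ 𝓟 s] fun _ => (1 : ℝ) :=
    Asymptotics.isBigO_iff.2 ⟨B, by
      rw [eventually_prod_principal_iff]
      exact Eventually.of_forall fun t x hx => by simpa using hb x hx⟩
  have := hbO.mul_isLittleO h
  simp only [one_mul] at this
  exact this.congr_left fun z => by ring

lemma HasUniformDerivAt.eventually_abs_sub_le (h : HasUniformDerivAt F p s t₀) {B : ℝ}
    (hp : ∀ x ∈ s, |p x| ≤ B) :
    ∀ᶠ t in 𝓝 t₀, ∀ x ∈ s, |F t x - F t₀ x| ≤ (B + 1) * |t - t₀| := by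
  filter_upwards [hasUniformDerivAt_iff.1 h 1 one_pos] with t ht x hx
  calc |F t x - F t₀ x| = |(t - t₀) * p x + (F t x - F t₀ x - (t - t₀) * p x)| := by ring_nf
    _ ≤ |t - t₀| * |p x| + 1 * |t - t₀| := (abs_add_le _ _).trans (by
      rw [abs_mul]; gcongr; exact ht x hx)
    _ ≤ |t - t₀| * B + 1 * |t - t₀| := by gcongr; exact hp x hx
    _ = (B + 1) * |t - t₀| := by ring

lemma HasUniformDerivAt.tendstoUniformlyOn (h : HasUniformDerivAt F p s t₀) {B : ℝ}
    (hp : ∀ x ∈ s, |p x| ≤ B) : TendstoUniformlyOn F (F t₀) (𝓝 t₀) s := by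
  rw [Metric.tendstoUniformlyOn_iff]
  intro δ hδ
  have hsmall : ∀ᶠ t in 𝓝 t₀, (B + 1) * |t - t₀| < δ :=
    (show ContinuousAt (fun t => (B + 1) * |t - t₀|) t₀ by fun_prop).eventually_lt_const
      (by simpa using hδ)
  filter_upwards [h.eventually_abs_sub_le hp, hsmall] with t ht htδ x hx
  rw [dist_comm, Real.dist_eq]
  exact (ht x hx).trans_lt htδ

end UniformDerivative

section UniformChainRule

variable {X : Type*} [TopologicalSpace X] {K : Set X} {a b : X → ℝ}

lemma tendsto_add_mul_nhdsWithin (ha : ContinuousOn a K) (hb : ContinuousOn b K) {x : X}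
    (hx : x ∈ K) :
    Tendsto (fun z : ℝ × X => a z.2 + z.1 * b z.2) (𝓝 0 ×ˢ 𝓝[K] x) (𝓝 (a x)) := by
  simpa only [zero_mul, add_zero, Function.comp_apply] using
    ((ha x hx).tendsto.comp tendsto_snd).add ((tendsto_fst (f := 𝓝 (0 : ℝ)) (g := 𝓝[K] x)).mul
      ((hb x hx).tendsto.comp tendsto_snd))

lemma eventually_forall_add_mul_mem (hK : IsCompact K) (ha : ContinuousOn a K)
    (hb : ContinuousOn b K) {U : Set ℝ} (hU : ∀ x ∈ K, U ∈ 𝓝 (a x)) :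
    ∀ᶠ ε in 𝓝 (0 : ℝ), ∀ x ∈ K, a x + ε * b x ∈ U :=
  eventually_forall_mem_of_nhdsWithin hK fun x hx =>
    (tendsto_add_mul_nhdsWithin ha hb hx).eventually (hU x hx)

lemma hasUniformDerivAt_comp_add_mul (hK : IsCompact K) (ha : ContinuousOn a K)
    (hb : ContinuousOn b K) {Φ : ℝ → ℝ} {Φ' : X → ℝ}
    (hΦ : ∀ x ∈ K, HasStrictDerivAt Φ (Φ' x) (a x)) (hΦ' : ContinuousOn Φ' K) :
    HasUniformDerivAt (fun ε x => Φ (a x + ε * b x)) (fun x => b x * Φ' x) K 0 := by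
  refine hasUniformDerivAt_of_forall_nhdsWithin hK fun x hx => ?_
  let l : Filter (ℝ × X) := 𝓝 0 ×ˢ 𝓝[K] x
  have ha_tendsto : Tendsto (fun z : ℝ × X => a z.2) l (𝓝 (a x)) :=
    (ha x hx).tendsto.comp tendsto_snd
  have hb_bounded : (fun z : ℝ × X => b z.2) =O[l] fun _ => (1 : ℝ) :=
    ((hb x hx).tendsto.comp tendsto_snd).isBigO_one ℝ
  have hincrement : (fun z : ℝ × X => z.1 * b z.2) =O[l] fun z => z.1 := by
    simpa only [mul_one] using (Asymptotics.isBigO_refl (fun z : ℝ × X => z.1) l).mul hb_bounded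
  have hfrozen : (fun z : ℝ × X => Φ (a z.2 + z.1 * b z.2) - Φ (a z.2) - z.1 * b z.2 * Φ' x)
      =o[l] fun z => z.1 := by
    have := (hΦ x hx).isLittleO.comp_tendsto
      ((tendsto_add_mul_nhdsWithin ha hb hx).prodMk_nhds ha_tendsto)
    simp only [Function.comp_def, add_sub_cancel_left] at this
    exact (this.trans_isBigO hincrement).congr_left fun z => by
      simp [mul_comm]
  have hΦ'_sub : (fun z : ℝ × X => Φ' x - Φ' z.2) =o[l] fun _ => (1 : ℝ) := by
    rw [Asymptotics.isLittleO_one_iff]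
    simpa using (((hΦ' x hx).tendsto.comp tendsto_snd).const_sub (Φ' x) :
      Tendsto (fun z : ℝ × X => Φ' x - Φ' z.2) l _)
  have hunfreeze : (fun z : ℝ × X => z.1 * b z.2 * (Φ' x - Φ' z.2)) =o[l] fun z => z.1 := by
    simpa only [mul_one] using hincrement.mul_isLittleO hΦ'_sub
  simp only [sub_zero, zero_mul, add_zero]
  exact (hfrozen.add hunfreeze).congr_left fun z => by ring

end UniformChainRule

section Envelope

variable {X : Type*} [TopologicalSpace X] {K : Set X} {v : X}

lemma tendsto_maximizer {ι : Type*} {l : Filter ι} {F : ι → X → ℝ} {f : X → ℝ} {w : ι → X}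
    (hK : IsCompact K) (hf : ContinuousOn f K) (hF : TendstoUniformlyOn F f l K)
    (hw : ∀ᶠ i in l, w i ∈ K ∧ IsMaxOn (F i) K (w i))
    (hv : ∀ x ∈ K, IsMaxOn f K x → x = v) : Tendsto w l (𝓝 v) := by
  refine hK.tendsto_nhds_of_unique_mapClusterPt (hw.mono fun i hi => hi.1)
    fun x hx hcluster => hv x hx <| isMaxOn_iff.2 fun y hy =>
      le_of_forall_pos_le_add fun δ hδ => ?_
  have hnear : ∀ᶠ z in 𝓝 x, z ∈ K → f z < f x + δ / 3 :=
    eventually_nhdsWithin_iff.1 ((hf x hx).eventually_lt_const (by linarith))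
  obtain ⟨i, hfx, ⟨hwK, hmax⟩, hclose⟩ := ((hcluster.frequently hnear).and_eventually
    (hw.and (Metric.tendstoUniformlyOn_iff.1 hF (δ / 3) (by positivity)))).exists
  simp only [Real.dist_eq, abs_lt] at hclose
  have hFmax : F i y ≤ F i (w i) := hmax hy
  linarith [hfx hwK, (hclose y hy).2, (hclose _ hwK).1]

variable {F : ℝ → X → ℝ} {p : X → ℝ} {M : ℝ → ℝ} {t₀ : ℝ}

lemma HasUniformDerivAt.exists_tendsto_maximizer (h : HasUniformDerivAt F p K t₀)
    (hK : IsCompact K) (hF : ContinuousOn (F t₀) K) (hp : ContinuousOn p K)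
    (hM : ∀ᶠ t in 𝓝 t₀, IsGreatest (F t '' K) (M t)) (hmax : ∀ x ∈ K, F t₀ x = M t₀ → x = v) :
    ∃ w : ℝ → X, Tendsto w (𝓝 t₀) (𝓝[K] v) ∧ ∀ᶠ t in 𝓝 t₀, w t ∈ K ∧ F t (w t) = M t := by
  obtain ⟨B, hB⟩ := hK.exists_bound_of_continuousOn hp
  obtain ⟨w, hw⟩ := (hM.mono fun t ht => ht.1).choice
  have hw_max : ∀ᶠ t in 𝓝 t₀, w t ∈ K ∧ IsMaxOn (F t) K (w t) := by
    filter_upwards [hM, hw] with t ht hwt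
    exact ⟨hwt.1, fun x hx => hwt.2.symm ▸ ht.2 ⟨x, hx, rfl⟩⟩
  refine ⟨w, tendsto_nhdsWithin_iff.2 ⟨tendsto_maximizer hK hF (h.tendstoUniformlyOn hB) hw_max
    fun x hx hx_max => hmax x hx ?_, hw.mono fun t ht => ht.1⟩, hw⟩
  obtain ⟨y, hy, hyM⟩ := hM.self_of_nhds.1
  exact (hM.self_of_nhds.2 ⟨x, hx, rfl⟩).antisymm (hyM ▸ hx_max hy)

theorem HasUniformDerivAt.hasDerivAt_of_isGreatest_image (h : HasUniformDerivAt F p K t₀)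
    (hK : IsCompact K) (hF : ContinuousOn (F t₀) K) (hp : ContinuousOn p K)
    (hM : ∀ᶠ t in 𝓝 t₀, IsGreatest (F t '' K) (M t)) (hmax : ∀ x ∈ K, F t₀ x = M t₀ → x = v) :
    HasDerivAt M (p v) t₀ := by
  obtain ⟨w, hw_tendsto, hw⟩ := h.exists_tendsto_maximizer hK hF hp hM hmax
  obtain ⟨hvK, hvM⟩ : v ∈ K ∧ F t₀ v = M t₀ := by
    obtain ⟨y, hy, hyM⟩ := hM.self_of_nhds.1
    exact hmax y hy hyM ▸ ⟨hy, hyM⟩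
  rw [hasDerivAt_iff_isLittleO, Asymptotics.isLittleO_iff]
  intro c hc
  have hpw : ∀ᶠ t in 𝓝 t₀, |p (w t) - p v| < c / 2 :=
    ((hp v hvK).tendsto.comp hw_tendsto).eventually (Metric.ball_mem_nhds _ (half_pos hc))
  filter_upwards [hM, hw, hpw, hasUniformDerivAt_iff.1 h (c / 2) (half_pos hc)]
    with t ht ⟨hwK, hwM⟩ hpt hexp
  have hlower : F t v - F t₀ v ≤ M t - M t₀ := by linarith [ht.2 ⟨v, hvK, rfl⟩]
  have hupper : M t - M t₀ ≤ F t (w t) - F t₀ (w t) := by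
    linarith [hM.self_of_nhds.2 ⟨w t, hwK, rfl⟩]
  have hslope : |(t - t₀) * (p (w t) - p v)| ≤ |t - t₀| * (c / 2) := by
    rw [abs_mul]
    gcongr
  have hexp_v := abs_le.1 (hexp v hvK)
  have hexp_w := abs_le.1 (hexp _ hwK)
  rw [abs_le] at hslope
  rw [smul_eq_mul, Real.norm_eq_abs, Real.norm_eq_abs, abs_le]
  constructor <;> nlinarith [abs_nonneg (t - t₀)]

end Envelope

/-! ### Integration against densities and spherical measures -/

section SignedMeasureWithDensity

variable {X Y : Type*} [MeasurableSpace X] [MeasurableSpace Y] {ν : Measure X} {F f : X → ℝ}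

lemma integrable_withDensityᵥ (hF : Integrable F ν) (hf : AEStronglyMeasurable f ν)
    (hFf : Integrable (fun x => F x * f x) ν) : (ν.withDensityᵥ F).Integrable f := by
  rw [VectorMeasure.Integrable, Measure.variation_withDensityᵥ hF,
    integrable_withDensity_iff_integrable_smul₀' hF.aestronglyMeasurable.enorm
      (Eventually.of_forall fun _ => enorm_lt_top)]
  simp only [toReal_enorm, smul_eq_mul]
  exact hFf.congr' (hF.aestronglyMeasurable.norm.mul hf) (Eventually.of_forall fun x => by simp)

lemma integral_withDensity_ofReal_sub_integral_withDensity_ofReal_neg (hF : AEMeasurable F ν)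
    (hpos : Integrable f (ν.withDensity fun x => ENNReal.ofReal (F x)))
    (hneg : Integrable f (ν.withDensity fun x => ENNReal.ofReal (-F x))) :
    ∫ x, f x ∂(ν.withDensity fun x => ENNReal.ofReal (F x)) -
      ∫ x, f x ∂(ν.withDensity fun x => ENNReal.ofReal (-F x)) = ∫ x, F x * f x ∂ν := by
  have hfinite (u : X → ℝ) : ∀ᵐ x ∂ν, ENNReal.ofReal (u x) < ⊤ :=
    Eventually.of_forall fun _ => ENNReal.ofReal_lt_top
  have hFpos : AEMeasurable (fun x => ENNReal.ofReal (F x)) ν := hF.ennreal_ofReal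
  have hFneg : AEMeasurable (fun x => ENNReal.ofReal (-F x)) ν := hF.neg.ennreal_ofReal
  rw [integral_withDensity_eq_integral_toReal_smul₀ hFpos (hfinite _),
    integral_withDensity_eq_integral_toReal_smul₀ hFneg (hfinite _),
    ← integral_sub ((integrable_withDensity_iff_integrable_smul₀' hFpos (hfinite _)).1 hpos)
      ((integrable_withDensity_iff_integrable_smul₀' hFneg (hfinite _)).1 hneg)]
  simp only [ENNReal.toReal_ofReal', smul_eq_mul, ← sub_mul,
    max_zero_sub_max_neg_zero_eq_self]

lemma integral_withDensityᵥ (hF : Integrable F ν) (hf : AEStronglyMeasurable f ν)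
    (hFf : Integrable (fun x => F x * f x) ν) :
    ∫ᵛ x, f x ∂•(ν.withDensityᵥ F) = ∫ x, F x * f x ∂ν := by
  have hvar : Integrable f (ν.withDensity fun x => ‖F x‖ₑ) := by
    simpa only [VectorMeasure.Integrable, Measure.variation_withDensityᵥ hF]
      using integrable_withDensityᵥ hF hf hFf
  have hpos : Integrable f (ν.withDensity fun x => ENNReal.ofReal (F x)) :=
    hvar.mono_measure (withDensity_mono (Eventually.of_forall fun x => Real.ofReal_le_enorm (F x)))
  have hneg : Integrable f (ν.withDensity fun x => ENNReal.ofReal (-F x)) :=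
    hvar.mono_measure (withDensity_mono (Eventually.of_forall fun x => by
      simpa only [enorm_neg] using Real.ofReal_le_enorm (-F x)))
  have := isFiniteMeasure_withDensity_ofReal hF.2
  have : IsFiniteMeasure (ν.withDensity fun x => ENNReal.ofReal (-F x)) :=
    isFiniteMeasure_withDensity_ofReal hF.neg.2
  have hlsmul : ContinuousLinearMap.lsmul ℝ ℝ =
      (ContinuousLinearMap.lsmul ℝ ℝ (E := ℝ)).flip := by
    ext
    simp
  rw [withDensityᵥ_eq_withDensity_pos_part_sub_withDensity_neg_part hF, hlsmul,
    VectorMeasure.integral_sub_vectorMeasure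
      (by rwa [VectorMeasure.Integrable, Measure.variation_toSignedMeasure])
      (by rwa [VectorMeasure.Integrable, Measure.variation_toSignedMeasure]),
    VectorMeasure.integral_toSignedMeasure, VectorMeasure.integral_toSignedMeasure]
  exact integral_withDensity_ofReal_sub_integral_withDensity_ofReal_neg
    hF.aestronglyMeasurable.aemeasurable hpos hneg

lemma integral_map_withDensityᵥ (hF : Integrable F ν) {A : X → Y} (hA : Measurable A) {f : Y → ℝ}
    (hf : Measurable f) (hFf : Integrable (fun x => F x * f (A x)) ν) :
    ∫ᵛ y, f y ∂•((ν.withDensityᵥ F).map A) = ∫ x, F x * f (A x) ∂ν := by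
  have hfA : AEStronglyMeasurable (fun x => f (A x)) ν := (hf.comp hA).aestronglyMeasurable
  rw [VectorMeasure.integral_map hA hf.aestronglyMeasurable (integrable_withDensityᵥ hF hfA hFf)]
  exact integral_withDensityᵥ hF hfA hFf

end SignedMeasureWithDensity

lemma ae_toSphere_of_ae {E : Type*} [NormedAddCommGroup E] [NormedSpace ℝ E] [MeasurableSpace E]
    [BorelSpace E] {μ : Measure E} {P : E → Prop} (hP : ∀ᵐ x ∂μ, P x)
    (hP_meas : MeasurableSet {x | P x}) (hP_smul : ∀ r : ℝ, 0 < r → ∀ x, P (r • x) → P x) :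
    ∀ᵐ u : Metric.sphere (0 : E) 1 ∂μ.toSphere, P u := by
  have hmeas : MeasurableSet {u : Metric.sphere (0 : E) 1 | ¬ P u} :=
    measurable_subtype_coe hP_meas.compl
  rw [ae_iff, Measure.toSphere_apply' _ hmeas]
  refine mul_eq_zero_of_right _ (measure_mono_null ?_ (ae_iff.1 hP))
  rintro _ ⟨r, hr, _, ⟨u, hu, rfl⟩, rfl⟩ hru
  exact hu (hP_smul r hr.1 u hru)

/-! ### Convex bodies around the origin -/

variable {n : ℕ}

lemma Sphere.norm_coe (u : Sphere n) : ‖(u : EuclideanSpace ℝ (Fin n))‖ = 1 := by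
  simp only [norm_eq_of_mem_sphere]

lemma Sphere.coe_ne_zero (u : Sphere n) : (u : EuclideanSpace ℝ (Fin n)) ≠ 0 :=
  ne_zero_of_mem_unit_sphere u

lemma Sphere.abs_inner_le_one (u v : Sphere n) :
    |inner ℝ (u : EuclideanSpace ℝ (Fin n)) v| ≤ 1 := by
  simpa only [u.norm_coe, v.norm_coe, mul_one] using
    abs_real_inner_le_norm (u : EuclideanSpace ℝ (Fin n)) v

lemma Sphere.exists_eq_smul {x : EuclideanSpace ℝ (Fin n)} (hx : x ≠ 0) :
    ∃ u : Sphere n, x = ‖x‖ • (u : EuclideanSpace ℝ (Fin n)) := by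
  have hx' : ‖x‖ ≠ 0 := norm_ne_zero_iff.2 hx
  exact ⟨⟨‖x‖⁻¹ • x, by simp [norm_smul, hx']⟩, by simp [smul_smul, hx']⟩

instance : IsFiniteMeasure (sphereMeasure n) :=
  inferInstanceAs (IsFiniteMeasure (volume : Measure (EuclideanSpace ℝ (Fin n))).toSphere)

lemma integrable_sphereMeasure_of_continuous {f : Sphere n → ℝ} (hf : Continuous f) :
    Integrable f (sphereMeasure n) :=
  hf.integrable_of_hasCompactSupport (HasCompactSupport.of_compactSpace f)

lemma continuous_of_continuousOn_Ioi_prod_univ {F : ℝ → Sphere n → ℝ}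
    (hF : ContinuousOn (fun p : ℝ × Sphere n => F p.1 p.2) (Ioi 0 ×ˢ univ))
    {ρ : Sphere n → ℝ} (hρ : Continuous ρ) (hρ_pos : ∀ u, 0 < ρ u) :
    Continuous fun u => F (ρ u) u :=
  hF.comp_continuous (hρ.prodMk continuous_id) fun u => ⟨hρ_pos u, mem_univ u⟩

/-- The class `𝒦ₒⁿ` of convex bodies in `ℝⁿ` containing the origin in their interior. The
radial function of such a body is studied through its Minkowski functional `gauge K = 1 / ρ_K`. -/
structure IsConvexBodyAroundZero (K : Set (EuclideanSpace ℝ (Fin n))) : Prop where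
  isCompact : IsCompact K
  convex : Convex ℝ K
  mem_nhds_zero : K ∈ 𝓝 0

namespace IsConvexBodyAroundZero

variable {K : Set (EuclideanSpace ℝ (Fin n))} (hK : IsConvexBodyAroundZero K)
include hK

lemma gauge_pos {x : EuclideanSpace ℝ (Fin n)} (hx : x ≠ 0) : 0 < gauge K x :=
  (_root_.gauge_pos (absorbent_nhds_zero hK.mem_nhds_zero)
    (NormedSpace.isVonNBounded_of_isBounded ℝ hK.isCompact.isBounded)).2 hx

lemma gauge_le_one_iff {x : EuclideanSpace ℝ (Fin n)} : gauge K x ≤ 1 ↔ x ∈ K := by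
  rw [gauge_le_one_iff_mem_closure hK.convex hK.mem_nhds_zero, hK.isCompact.isClosed.closure_eq]

lemma continuous_gauge : Continuous (gauge K) :=
  _root_.continuous_gauge hK.convex hK.mem_nhds_zero

lemma continuous_gauge_coe : Continuous fun u : Sphere n => gauge K u :=
  hK.continuous_gauge.comp continuous_subtype_val

lemma radialFn_eq_inv_gauge (u : Sphere n) : radialFn K u = (gauge K u)⁻¹ := by
  have hpos := hK.gauge_pos u.coe_ne_zero
  have : {r : ℝ | 0 < r ∧ r • (u : EuclideanSpace ℝ (Fin n)) ∈ K} = Ioc 0 (gauge K u)⁻¹ := by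
    ext r
    refine and_congr_right fun hr => ?_
    rw [← hK.gauge_le_one_iff, gauge_smul_of_nonneg hr.le, smul_eq_mul, ← le_div_iff₀ hpos, one_div]
  rw [radialFn, this, csSup_Ioc (inv_pos.2 hpos)]

lemma radialFn_pos (u : Sphere n) : 0 < radialFn K u := by
  rw [hK.radialFn_eq_inv_gauge]
  exact inv_pos.2 (hK.gauge_pos u.coe_ne_zero)

lemma continuous_radialFn : Continuous (radialFn K) := by
  simp only [funext hK.radialFn_eq_inv_gauge]
  exact hK.continuous_gauge_coe.inv₀ fun u => (hK.gauge_pos u.coe_ne_zero).ne'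

lemma continuous_comp_radialFn {F : ℝ → Sphere n → ℝ}
    (hF : ContinuousOn (fun p : ℝ × Sphere n => F p.1 p.2) (Ioi 0 ×ˢ univ)) :
    Continuous fun u => F (radialFn K u) u :=
  continuous_of_continuousOn_Ioi_prod_univ hF hK.continuous_radialFn hK.radialFn_pos

lemma mem_frontier_iff {x : EuclideanSpace ℝ (Fin n)} : x ∈ frontier K ↔ gauge K x = 1 :=
  (gauge_eq_one_iff_mem_frontier hK.convex hK.mem_nhds_zero).symm

lemma radialFn_smul_mem_frontier (u : Sphere n) :
    radialFn K u • (u : EuclideanSpace ℝ (Fin n)) ∈ frontier K := by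
  rw [hK.mem_frontier_iff, gauge_smul_of_nonneg (hK.radialFn_pos u).le, hK.radialFn_eq_inv_gauge,
    smul_eq_mul, inv_mul_cancel₀ (hK.gauge_pos u.coe_ne_zero).ne']

lemma inner_le_supportFn {x : EuclideanSpace ℝ (Fin n)} (hx : x ∈ K) (v : Sphere n) :
    inner ℝ x v ≤ supportFn K v := by
  rw [real_inner_comm]
  exact le_csSup (hK.isCompact.bddAbove_image (by fun_prop)) ⟨x, hx, rfl⟩

lemma inner_le_gauge_mul_supportFn (x : EuclideanSpace ℝ (Fin n)) (v : Sphere n) :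
    inner ℝ x v ≤ gauge K x * supportFn K v := by
  rcases eq_or_ne x 0 with rfl | hx
  · simp only [inner_zero_left, gauge_zero, zero_mul, le_refl]
  have hpos := hK.gauge_pos hx
  have hmem : (gauge K x)⁻¹ • x ∈ K := by
    rw [← hK.gauge_le_one_iff, gauge_smul_of_nonneg (inv_nonneg.2 hpos.le), smul_eq_mul,
      inv_mul_cancel₀ hpos.ne']
  simpa only [real_inner_smul_left, inv_mul_le_iff₀ hpos] using hK.inner_le_supportFn hmem v

lemma supportFn_pos (v : Sphere n) : 0 < supportFn K v := by
  have hself := hK.inner_le_gauge_mul_supportFn v v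
  rw [real_inner_self_eq_norm_sq, v.norm_coe, one_pow] at hself
  exact pos_of_mul_pos_right (one_pos.trans_le hself) (gauge_nonneg _)

lemma continuous_supportFn : Continuous (supportFn K) :=
  hK.isCompact.continuous_sSup (by fun_prop)

lemma mem_radialGaussImage_iff {u v : Sphere n} :
    v ∈ radialGaussImage K {u} ↔
      inner ℝ (u : EuclideanSpace ℝ (Fin n)) v = gauge K u * supportFn K v := by
  have hiff : inner ℝ (radialFn K u • (u : EuclideanSpace ℝ (Fin n))) v = supportFn K v ↔
      inner ℝ (u : EuclideanSpace ℝ (Fin n)) v = gauge K u * supportFn K v := by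
    rw [hK.radialFn_eq_inv_gauge, real_inner_smul_left,
      inv_mul_eq_iff_eq_mul₀ (hK.gauge_pos u.coe_ne_zero).ne']
  rw [← hiff]
  simp only [radialGaussImage, sphericalImage, supportHyperplane, mem_ofPred_eq, mem_singleton_iff,
    exists_eq_left]
  exact ⟨by rintro ⟨_, ⟨-, rfl⟩, h⟩; exact h,
    fun h => ⟨_, ⟨hK.radialFn_smul_mem_frontier u, rfl⟩, h⟩⟩

lemma exists_supportFn_eq_inner {x : EuclideanSpace ℝ (Fin n)} (hx : x ∈ frontier K) :
    ∃ v : Sphere n, supportFn K v = inner ℝ x v := by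
  obtain ⟨f, hf⟩ := geometric_hahn_banach_open_point hK.convex.interior isOpen_interior hx.2
  have hf_le : ∀ y ∈ K, f y ≤ f x := by
    have : closure (interior K) ⊆ {y | f y ≤ f x} :=
      closure_minimal (fun y hy => (hf y hy).le) (isClosed_le f.continuous continuous_const)
    rw [hK.convex.closure_interior_eq_closure_of_nonempty_interior
      ⟨0, mem_interior_iff_mem_nhds.2 hK.mem_nhds_zero⟩] at this
    exact fun y hy => this (subset_closure hy)
  obtain ⟨w, rfl⟩ := (InnerProductSpace.toDual ℝ (EuclideanSpace ℝ (Fin n))).surjective f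
  simp only [InnerProductSpace.toDual_apply_apply] at hf hf_le
  have hw : w ≠ 0 := by
    rintro rfl
    simpa only [inner_zero_left, lt_self_iff_false] using
      hf 0 (mem_interior_iff_mem_nhds.2 hK.mem_nhds_zero)
  obtain ⟨v, hv⟩ := Sphere.exists_eq_smul hw
  refine ⟨v, le_antisymm (csSup_le ⟨_, 0, mem_of_mem_nhds hK.mem_nhds_zero, rfl⟩ ?_)
    (hK.inner_le_supportFn (hK.isCompact.isClosed.frontier_subset hx) v)⟩
  rintro _ ⟨y, hy, rfl⟩
  have := hf_le y hy
  rw [hv, real_inner_smul_left, real_inner_smul_left,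
    mul_le_mul_iff_of_pos_left (norm_pos_iff.2 hw)] at this
  rwa [real_inner_comm (v : EuclideanSpace ℝ (Fin n)) x]

lemma radialGaussMap_mem (u : Sphere n) : radialGaussMap K u ∈ radialGaussImage K {u} := by
  have hne : (radialGaussImage K {u}).Nonempty := by
    obtain ⟨v, hv⟩ := hK.exists_supportFn_eq_inner (hK.radialFn_smul_mem_frontier u)
    exact ⟨v, _, ⟨hK.radialFn_smul_mem_frontier u, u, rfl, rfl⟩, hv.symm⟩
  rw [radialGaussMap, dif_pos hne]
  exact hne.choose_spec

lemma supportFn_smul_gradient_gauge {u v : Sphere n}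
    (hu : DifferentiableAt ℝ (gauge K) (u : EuclideanSpace ℝ (Fin n)))
    (hv : v ∈ radialGaussImage K {u}) :
    supportFn K v • gradient (gauge K) u = (v : EuclideanSpace ℝ (Fin n)) := by
  rw [hK.mem_radialGaussImage_iff] at hv
  -- The nonnegative function `x ↦ gauge K x * h_K(v) - ⟨v, x⟩` vanishes at `u`.
  have hmin : IsLocalMin (fun x => gauge K x * supportFn K v -
      innerSL ℝ (v : EuclideanSpace ℝ (Fin n)) x) (u : EuclideanSpace ℝ (Fin n)) := by
    refine Eventually.of_forall fun x => ?_
    simp only [innerSL_apply_apply, real_inner_comm, hv, sub_self, sub_nonneg]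
    exact hK.inner_le_gauge_mul_supportFn x v
  have hcritical := hmin.hasFDerivAt_eq_zero
    ((hu.hasFDerivAt.mul_const _).sub (innerSL ℝ (v : EuclideanSpace ℝ (Fin n))).hasFDerivAt)
  refine ext_inner_right ℝ fun y => ?_
  have hy := DFunLike.congr_fun (sub_eq_zero.1 hcritical) y
  simp only [smul_apply, innerSL_apply_apply, smul_eq_mul] at hy
  rw [real_inner_smul_left, ← hy, gradient, InnerProductSpace.toDual_symm_apply]

lemma coe_eq_inv_norm_smul_gradient_gauge {u v : Sphere n}
    (hu : DifferentiableAt ℝ (gauge K) (u : EuclideanSpace ℝ (Fin n)))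
    (hv : v ∈ radialGaussImage K {u}) :
    (v : EuclideanSpace ℝ (Fin n)) = ‖gradient (gauge K) u‖⁻¹ • gradient (gauge K) u := by
  have hgrad := hK.supportFn_smul_gradient_gauge hu hv
  have hnorm : supportFn K v * ‖gradient (gauge K) u‖ = 1 := by
    rw [← Real.norm_of_nonneg (hK.supportFn_pos v).le, ← norm_smul, hgrad, v.norm_coe]
  rw [← hgrad, ← eq_inv_of_mul_eq_one_left hnorm]

lemma eq_radialGaussMap {u v : Sphere n}
    (hu : DifferentiableAt ℝ (gauge K) (u : EuclideanSpace ℝ (Fin n)))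
    (hv : v ∈ radialGaussImage K {u}) : v = radialGaussMap K u :=
  Subtype.ext <| (hK.coe_eq_inv_norm_smul_gradient_gauge hu hv).trans
    (hK.coe_eq_inv_norm_smul_gradient_gauge hu (hK.radialGaussMap_mem u)).symm

lemma mem_reverseRadialGaussImage_iff_exists {u : Sphere n} {S : Set (Sphere n)} :
    u ∈ reverseRadialGaussImage K S ↔ ∃ v ∈ S, v ∈ radialGaussImage K {u} := by
  simp only [hK.mem_radialGaussImage_iff]
  constructor
  · rintro ⟨x, ⟨hx, v, hvS, hxv⟩, hu⟩
    refine ⟨v, hvS, ?_⟩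
    rw [hu, real_inner_smul_left, gauge_smul_of_nonneg (inv_nonneg.2 (norm_nonneg x)),
      hK.mem_frontier_iff.1 hx, smul_eq_mul, mul_one]
    exact congrArg _ hxv
  · rintro ⟨v, hvS, hv⟩
    have hρ := hK.radialFn_pos u
    refine ⟨_, ⟨hK.radialFn_smul_mem_frontier u, v, hvS, ?_⟩, ?_⟩
    · rw [supportHyperplane, mem_ofPred_eq, real_inner_smul_left, hv, hK.radialFn_eq_inv_gauge,
        inv_mul_cancel_left₀ (hK.gauge_pos u.coe_ne_zero).ne']
    · rw [norm_smul, u.norm_coe, mul_one, Real.norm_of_nonneg hρ.le, inv_smul_smul₀ hρ.ne']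

lemma mem_reverseRadialGaussImage_iff {u : Sphere n} {S : Set (Sphere n)}
    (hu : DifferentiableAt ℝ (gauge K) (u : EuclideanSpace ℝ (Fin n))) :
    u ∈ reverseRadialGaussImage K S ↔ radialGaussMap K u ∈ S := by
  rw [hK.mem_reverseRadialGaussImage_iff_exists]
  exact ⟨fun ⟨v, hvS, hv⟩ => hK.eq_radialGaussMap hu hv ▸ hvS,
    fun h => ⟨_, h, hK.radialGaussMap_mem u⟩⟩

lemma ae_differentiableAt_gauge : ∀ᵐ u : Sphere n ∂sphereMeasure n,
    DifferentiableAt ℝ (gauge K) (u : EuclideanSpace ℝ (Fin n)) := by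
  obtain ⟨_, hlip⟩ := hK.convex.lipschitz_gauge hK.mem_nhds_zero
  refine ae_toSphere_of_ae hlip.ae_differentiableAt
    (measurableSet_of_differentiableAt ℝ (gauge K)) fun r hr x hrx => ?_
  have hscaled : DifferentiableAt ℝ (fun y => r⁻¹ * gauge K (r • y)) x :=
    (DifferentiableAt.comp (g := gauge K) x hrx (differentiableAt_id.const_smul r)).const_mul _
  refine hscaled.congr_of_eventuallyEq (Eventually.of_forall fun y => ?_)
  simp only [gauge_smul_of_nonneg hr.le, smul_eq_mul, inv_mul_cancel_left₀ hr.ne']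

lemma aemeasurable_radialGaussMap : AEMeasurable (radialGaussMap K) (sphereMeasure n) := by
  have hgrad : Measurable (gradient (gauge K)) :=
    (InnerProductSpace.toDual ℝ (EuclideanSpace ℝ (Fin n))).symm.continuous.measurable.comp
      (measurable_fderiv ℝ _)
  rw [← (MeasurableEmbedding.subtype_coe
    Metric.isClosed_sphere.measurableSet).aemeasurable_comp_iff]
  refine ⟨fun u => ‖gradient (gauge K) u‖⁻¹ • gradient (gauge K) u,
    (hgrad.norm.inv.smul hgrad).comp measurable_subtype_coe, ?_⟩
  filter_upwards [hK.ae_differentiableAt_gauge] with u hu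
  exact hK.coe_eq_inv_norm_smul_gradient_gauge hu (hK.radialGaussMap_mem u)

lemma integrable_curvatureIntegrand {G : ℝ → Sphere n → ℝ}
    (hG_t : ContinuousOn (fun p : ℝ × Sphere n => partialT G p.1 p.2) (Ioi 0 ×ˢ univ))
    {ψ : ℝ → ℝ} (hψ : ContinuousOn ψ (Ioi 0)) (hψ_ne : ∀ t, 0 < t → ψ t ≠ 0) :
    Integrable (curvatureIntegrand G ψ K) (sphereMeasure n) := by
  have hinv : Continuous fun v => (ψ (supportFn K v))⁻¹ :=
    (hψ.comp_continuous hK.continuous_supportFn hK.supportFn_pos).inv₀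
      fun v => hψ_ne _ (hK.supportFn_pos v)
  obtain ⟨B, hB⟩ := isCompact_univ.exists_bound_of_continuousOn hinv.continuousOn
  exact (integrable_sphereMeasure_of_continuous
    (hK.continuous_radialFn.mul (hK.continuous_comp_radialFn hG_t))).mul_bdd (c := B)
      (hinv.measurable.comp_aemeasurable hK.aemeasurable_radialGaussMap).aestronglyMeasurable
      (Eventually.of_forall fun u => hB _ (mem_univ _))

end IsConvexBodyAroundZero

/-! ### Dual Orlicz curvature measures -/

section CurvatureMeasure

variable {G : ℝ → Sphere n → ℝ} {ψ : ℝ → ℝ} {K : Set (EuclideanSpace ℝ (Fin n))}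

lemma IsDualOrliczCurvatureMeasure.eq {μ₁ μ₂ : SignedMeasure (Sphere n)}
    (h₁ : IsDualOrliczCurvatureMeasure G ψ K μ₁) (h₂ : IsDualOrliczCurvatureMeasure G ψ K μ₂) :
    μ₁ = μ₂ :=
  VectorMeasure.ext fun E hE => by rw [h₁.apply_eq E hE, h₂.apply_eq E hE]

lemma IsDualOrliczCurvatureMeasure.dualOrliczCurvatureMeasure_eq {μ : SignedMeasure (Sphere n)}
    (h : IsDualOrliczCurvatureMeasure G ψ K μ) : dualOrliczCurvatureMeasure G ψ K = μ := by
  have hex : ∃ μ, IsDualOrliczCurvatureMeasure G ψ K μ := ⟨μ, h⟩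
  rw [dualOrliczCurvatureMeasure, dif_pos hex]
  exact hex.choose_spec.eq h

namespace IsConvexBodyAroundZero

lemma isDualOrliczCurvatureMeasure_map (hK : IsConvexBodyAroundZero K)
    (hint : Integrable (curvatureIntegrand G ψ K) (sphereMeasure n)) :
    IsDualOrliczCurvatureMeasure G ψ K
      (((sphereMeasure n).withDensityᵥ fun u => (n : ℝ)⁻¹ * curvatureIntegrand G ψ K u).map
        (hK.aemeasurable_radialGaussMap.mk _)) := by
  have hα := hK.aemeasurable_radialGaussMap.measurable_mk
  have hpreimage (E : Set (Sphere n)) : (hK.aemeasurable_radialGaussMap.mk _ ⁻¹' E : Set (Sphere n))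
      =ᵐ[sphereMeasure n] reverseRadialGaussImage K E := by
    rw [eventuallyEq_set]
    filter_upwards [hK.ae_differentiableAt_gauge, hK.aemeasurable_radialGaussMap.ae_eq_mk]
      with u hu hmk
    rw [hK.mem_reverseRadialGaussImage_iff hu, mem_preimage, ← hmk]
  refine ⟨hint, fun E hE => (hα hE).nullMeasurableSet.congr (hpreimage E), fun E hE => ?_⟩
  rw [VectorMeasure.map_apply _ hα hE, withDensityᵥ_apply (hint.const_mul _) (hα hE),
    integral_const_mul, setIntegral_congr_set (hpreimage E), one_div]

lemma isDualOrliczCurvatureMeasure_dualOrliczCurvatureMeasure (hK : IsConvexBodyAroundZero K)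
    (hint : Integrable (curvatureIntegrand G ψ K) (sphereMeasure n)) :
    IsDualOrliczCurvatureMeasure G ψ K (dualOrliczCurvatureMeasure G ψ K) := by
  have h := hK.isDualOrliczCurvatureMeasure_map hint
  rwa [h.dualOrliczCurvatureMeasure_eq]

lemma integrable_curvatureIntegrand_mul (hK : IsConvexBodyAroundZero K)
    (hint : Integrable (curvatureIntegrand G ψ K) (sphereMeasure n)) {f : Sphere n → ℝ}
    (hf : Measurable f) {B : ℝ} (hB : ∀ v, ‖f v‖ ≤ B) :
    Integrable (fun u => curvatureIntegrand G ψ K u * f (radialGaussMap K u)) (sphereMeasure n) :=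
  hint.mul_bdd (hf.comp_aemeasurable hK.aemeasurable_radialGaussMap).aestronglyMeasurable
    (Eventually.of_forall fun _ => hB _)

lemma integrable_inv_mul_curvatureIntegrand_mul_mk (hK : IsConvexBodyAroundZero K)
    {f : Sphere n → ℝ} (hfint : Integrable
      (fun u => curvatureIntegrand G ψ K u * f (radialGaussMap K u)) (sphereMeasure n)) :
    Integrable (fun u => (n : ℝ)⁻¹ * curvatureIntegrand G ψ K u *
      f (hK.aemeasurable_radialGaussMap.mk _ u)) (sphereMeasure n) := by
  refine (hfint.const_mul (n : ℝ)⁻¹).congr ?_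
  filter_upwards [hK.aemeasurable_radialGaussMap.ae_eq_mk] with u hmk
  rw [← hmk, mul_assoc]

lemma integrable_dualOrliczCurvatureMeasure (hK : IsConvexBodyAroundZero K)
    (hint : Integrable (curvatureIntegrand G ψ K) (sphereMeasure n)) {f : Sphere n → ℝ}
    (hf : Measurable f) (hfint : Integrable
      (fun u => curvatureIntegrand G ψ K u * f (radialGaussMap K u)) (sphereMeasure n)) :
    (dualOrliczCurvatureMeasure G ψ K).Integrable f := by
  rw [(hK.isDualOrliczCurvatureMeasure_map hint).dualOrliczCurvatureMeasure_eq]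
  exact VectorMeasure.Integrable.map hf.aestronglyMeasurable (integrable_withDensityᵥ
    (hint.const_mul _)
    (hf.comp hK.aemeasurable_radialGaussMap.measurable_mk).aestronglyMeasurable
    (hK.integrable_inv_mul_curvatureIntegrand_mul_mk hfint))

lemma integral_dualOrliczCurvatureMeasure (hK : IsConvexBodyAroundZero K)
    (hint : Integrable (curvatureIntegrand G ψ K) (sphereMeasure n)) {f : Sphere n → ℝ}
    (hf : Measurable f) (hfint : Integrable
      (fun u => curvatureIntegrand G ψ K u * f (radialGaussMap K u)) (sphereMeasure n)) :
    ∫ᵛ v, f v ∂•(dualOrliczCurvatureMeasure G ψ K) =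
      (n : ℝ)⁻¹ * ∫ u, curvatureIntegrand G ψ K u * f (radialGaussMap K u) ∂sphereMeasure n := by
  rw [(hK.isDualOrliczCurvatureMeasure_map hint).dualOrliczCurvatureMeasure_eq,
    integral_map_withDensityᵥ (hint.const_mul _) hK.aemeasurable_radialGaussMap.measurable_mk hf
      (hK.integrable_inv_mul_curvatureIntegrand_mul_mk hfint), ← integral_const_mul]
  refine integral_congr_ae ?_
  filter_upwards [hK.aemeasurable_radialGaussMap.ae_eq_mk] with u hmk
  rw [← hmk, mul_assoc]

end IsConvexBodyAroundZero

end CurvatureMeasure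

/-! ### Aleksandrov bodies -/

section AleksandrovBody

variable {Ω : Set (Sphere n)} {f f₁ f₂ : Sphere n → ℝ}

lemma mem_aleksandrovBody_iff {x : EuclideanSpace ℝ (Fin n)} :
    x ∈ aleksandrovBody Ω f ↔ ∀ v ∈ Ω, inner ℝ x (v : EuclideanSpace ℝ (Fin n)) ≤ f v := by
  simp only [aleksandrovBody, mem_iInter, mem_ofPred_eq]

lemma aleksandrovBody_congr (h : EqOn f₁ f₂ Ω) : aleksandrovBody Ω f₁ = aleksandrovBody Ω f₂ :=
  iInter₂_congr fun _ hv => by rw [h hv]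

lemma isClosed_aleksandrovBody : IsClosed (aleksandrovBody Ω f) :=
  isClosed_biInter fun _ _ => isClosed_le (by fun_prop) continuous_const

lemma convex_aleksandrovBody : Convex ℝ (aleksandrovBody Ω f) :=
  convex_iInter₂ fun v _ => convex_halfSpace_le
    ⟨fun x y => inner_add_left x y _, fun r x => real_inner_smul_left x _ r⟩ (f v)

lemma aleksandrovBody_mem_nhds_zero {m : ℝ} (hm : 0 < m) (hf : ∀ v ∈ Ω, m ≤ f v) :
    aleksandrovBody Ω f ∈ 𝓝 0 := by
  refine mem_of_superset (Metric.closedBall_mem_nhds 0 hm) fun x hx => ?_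
  refine mem_aleksandrovBody_iff.2 fun v hv => ?_
  calc inner ℝ x (v : EuclideanSpace ℝ (Fin n)) ≤ ‖x‖ := by
        simpa only [v.norm_coe, mul_one] using real_inner_le_norm x (v : EuclideanSpace ℝ (Fin n))
    _ ≤ m := mem_closedBall_zero_iff.1 hx
    _ ≤ f v := hf v hv

lemma exists_inner_pos (hΩ : ∀ v, ¬ Ω ⊆ closedHemisphere v) {x : EuclideanSpace ℝ (Fin n)}
    (hx : x ≠ 0) : ∃ v ∈ Ω, 0 < inner ℝ x (v : EuclideanSpace ℝ (Fin n)) := by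
  obtain ⟨u, hu⟩ := Sphere.exists_eq_smul (neg_ne_zero.2 hx)
  obtain ⟨v, hvΩ, hv⟩ := not_subset.1 (hΩ u)
  refine ⟨v, hvΩ, ?_⟩
  rw [closedHemisphere, mem_ofPred_eq, not_le, real_inner_comm] at hv
  rw [← neg_neg x, hu, inner_neg_left, real_inner_smul_left, neg_pos]
  exact mul_neg_of_pos_of_neg (norm_pos_iff.2 (neg_ne_zero.2 hx)) hv

lemma exists_pos_forall_exists_le_inner (hΩ_compact : IsCompact Ω)
    (hΩ : ∀ v, ¬ Ω ⊆ closedHemisphere v) :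
    ∃ c > 0, ∀ u : Sphere n, ∃ v ∈ Ω, c ≤ inner ℝ (u : EuclideanSpace ℝ (Fin n)) v := by
  have hmax (u : Sphere n) : IsGreatest
      ((fun v : Sphere n => inner ℝ (u : EuclideanSpace ℝ (Fin n)) v) '' Ω)
      (sSup ((fun v : Sphere n => inner ℝ (u : EuclideanSpace ℝ (Fin n)) v) '' Ω)) := by
    obtain ⟨v, hv, -⟩ := exists_inner_pos hΩ u.coe_ne_zero
    exact (hΩ_compact.image (by fun_prop)).isGreatest_sSup ⟨_, v, hv, rfl⟩
  have hcont : Continuous fun u : Sphere n =>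
      sSup ((fun v : Sphere n => inner ℝ (u : EuclideanSpace ℝ (Fin n)) v) '' Ω) :=
    hΩ_compact.continuous_sSup (by fun_prop)
  obtain ⟨c, hc, hle⟩ := isCompact_univ.exists_forall_le' hcont.continuousOn (a := (0 : ℝ))
    fun u _ => by
      obtain ⟨v, hv, hpos⟩ := exists_inner_pos hΩ u.coe_ne_zero
      exact hpos.trans_le ((hmax u).2 ⟨v, hv, rfl⟩)
  refine ⟨c, hc, fun u => ?_⟩
  obtain ⟨v, hv, hvu⟩ := (hmax u).1
  exact ⟨v, hv, (hle u (mem_univ u)).trans_eq hvu.symm⟩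

lemma isBounded_aleksandrovBody (hΩ_compact : IsCompact Ω) (hΩ : ∀ v, ¬ Ω ⊆ closedHemisphere v)
    {B : ℝ} (hf : ∀ v ∈ Ω, f v ≤ B) : Bornology.IsBounded (aleksandrovBody Ω f) := by
  obtain ⟨c, hc, hle⟩ := exists_pos_forall_exists_le_inner hΩ_compact hΩ
  refine isBounded_iff_forall_norm_le.2 ⟨max 0 (B / c), fun x hx => ?_⟩
  rcases eq_or_ne x 0 with rfl | hx0
  · simp only [norm_zero, le_max_left]
  obtain ⟨u, hu⟩ := Sphere.exists_eq_smul hx0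
  obtain ⟨v, hv, hcv⟩ := hle u
  refine le_max_of_le_right ((le_div_iff₀ hc).2 ?_)
  calc ‖x‖ * c ≤ ‖x‖ * inner ℝ (u : EuclideanSpace ℝ (Fin n)) v := by gcongr
    _ = inner ℝ x (v : EuclideanSpace ℝ (Fin n)) := by rw [← real_inner_smul_left, ← hu]
    _ ≤ B := (mem_aleksandrovBody_iff.1 hx v hv).trans (hf v hv)

/-- `f` is a positive continuous function on a closed set `Ω` of directions not contained in any
closed hemisphere, so that the Aleksandrov body `[f]` is a convex body around the origin. -/
structure IsAleksandrovData (Ω : Set (Sphere n)) (f : Sphere n → ℝ) : Prop where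
  isCompact : IsCompact Ω
  not_subset_closedHemisphere : ∀ v, ¬ Ω ⊆ closedHemisphere v
  continuousOn : ContinuousOn f Ω
  pos : ∀ v ∈ Ω, 0 < f v

namespace IsAleksandrovData

variable (hf : IsAleksandrovData Ω f)
include hf

lemma isConvexBodyAroundZero : IsConvexBodyAroundZero (aleksandrovBody Ω f) := by
  obtain ⟨m, hm, hfm⟩ := hf.isCompact.exists_forall_le' hf.continuousOn hf.pos
  obtain ⟨B, hB⟩ := hf.isCompact.exists_bound_of_continuousOn hf.continuousOn
  exact ⟨Metric.isCompact_of_isClosed_isBounded isClosed_aleksandrovBody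
      (isBounded_aleksandrovBody hf.isCompact hf.not_subset_closedHemisphere
        fun v hv => (le_abs_self _).trans (hB v hv)),
    convex_aleksandrovBody, aleksandrovBody_mem_nhds_zero hm hfm⟩

lemma supportFn_le {v : Sphere n} (hv : v ∈ Ω) : supportFn (aleksandrovBody Ω f) v ≤ f v := by
  refine csSup_le ⟨_, 0, mem_of_mem_nhds hf.isConvexBodyAroundZero.mem_nhds_zero, rfl⟩ ?_
  rintro _ ⟨x, hx, rfl⟩
  exact (real_inner_comm _ _).trans_le (mem_aleksandrovBody_iff.1 hx v hv)

lemma inner_mul_inv_le_gauge (x : EuclideanSpace ℝ (Fin n)) {v : Sphere n} (hv : v ∈ Ω) :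
    inner ℝ x (v : EuclideanSpace ℝ (Fin n)) * (f v)⁻¹ ≤ gauge (aleksandrovBody Ω f) x := by
  rw [← div_eq_mul_inv, div_le_iff₀ (hf.pos v hv)]
  exact (hf.isConvexBodyAroundZero.inner_le_gauge_mul_supportFn x v).trans
    (mul_le_mul_of_nonneg_left (hf.supportFn_le hv) (gauge_nonneg x))

lemma gauge_le {x : EuclideanSpace ℝ (Fin n)} {r : ℝ} (hr : 0 < r)
    (h : ∀ v ∈ Ω, inner ℝ x (v : EuclideanSpace ℝ (Fin n)) * (f v)⁻¹ ≤ r) :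
    gauge (aleksandrovBody Ω f) x ≤ r := by
  refine gauge_le_of_mem hr.le ((mem_smul_set_iff_inv_smul_mem₀ hr.ne' _ _).2 ?_)
  refine mem_aleksandrovBody_iff.2 fun v hv => ?_
  rw [real_inner_smul_left, inv_mul_le_iff₀ hr, ← div_le_iff₀ (hf.pos v hv), div_eq_mul_inv]
  exact h v hv

lemma continuousOn_inv : ContinuousOn (fun v => (f v)⁻¹) Ω :=
  hf.continuousOn.inv₀ fun v hv => (hf.pos v hv).ne'

lemma isGreatest_gauge {x : EuclideanSpace ℝ (Fin n)} (hx : x ≠ 0) :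
    IsGreatest ((fun v : Sphere n => inner ℝ x (v : EuclideanSpace ℝ (Fin n)) * (f v)⁻¹) '' Ω)
      (gauge (aleksandrovBody Ω f) x) := by
  refine ⟨?_, forall_mem_image.2 fun v hv => hf.inner_mul_inv_le_gauge x hv⟩
  obtain ⟨w, hwΩ, hw⟩ := exists_inner_pos hf.not_subset_closedHemisphere hx
  obtain ⟨v, hvΩ, hv⟩ := hf.isCompact.exists_isMaxOn ⟨w, hwΩ⟩
    (ContinuousOn.mul (f := fun v : Sphere n => inner ℝ x (v : EuclideanSpace ℝ (Fin n)))
      (by fun_prop) hf.continuousOn_inv)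
  have hv_pos : 0 < inner ℝ x (v : EuclideanSpace ℝ (Fin n)) * (f v)⁻¹ :=
    (mul_pos hw (inv_pos.2 (hf.pos w hwΩ))).trans_le (hv hwΩ)
  exact ⟨v, hvΩ, (hf.inner_mul_inv_le_gauge x hvΩ).antisymm (hf.gauge_le hv_pos fun _ => (hv ·))⟩

section Maximizer

variable {u v : Sphere n} (hv : v ∈ Ω)
  (huv : inner ℝ (u : EuclideanSpace ℝ (Fin n)) v * (f v)⁻¹ = gauge (aleksandrovBody Ω f) u)
include hv huv

lemma supportFn_eq_of_eq_gauge : supportFn (aleksandrovBody Ω f) v = f v := by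
  have hK := hf.isConvexBodyAroundZero
  refine (hf.supportFn_le hv).antisymm (le_of_mul_le_mul_left ?_ (hK.gauge_pos u.coe_ne_zero))
  rw [← huv, inv_mul_cancel_right₀ (hf.pos v hv).ne', huv]
  exact hK.inner_le_gauge_mul_supportFn u v

lemma mem_radialGaussImage_of_eq_gauge : v ∈ radialGaussImage (aleksandrovBody Ω f) {u} := by
  rw [hf.isConvexBodyAroundZero.mem_radialGaussImage_iff, hf.supportFn_eq_of_eq_gauge hv huv, ← huv,
    inv_mul_cancel_right₀ (hf.pos v hv).ne']

end Maximizer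

section Differentiable

variable {u : Sphere n}
  (hu : DifferentiableAt ℝ (gauge (aleksandrovBody Ω f)) (u : EuclideanSpace ℝ (Fin n)))
include hu

lemma eq_radialGaussMap_of_eq_gauge {v : Sphere n} (hv : v ∈ Ω)
    (huv : inner ℝ (u : EuclideanSpace ℝ (Fin n)) v * (f v)⁻¹ = gauge (aleksandrovBody Ω f) u) :
    v = radialGaussMap (aleksandrovBody Ω f) u :=
  hf.isConvexBodyAroundZero.eq_radialGaussMap hu (hf.mem_radialGaussImage_of_eq_gauge hv huv)

lemma radialGaussMap_mem_and_supportFn_eq :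
    radialGaussMap (aleksandrovBody Ω f) u ∈ Ω ∧
      supportFn (aleksandrovBody Ω f) (radialGaussMap (aleksandrovBody Ω f) u) =
        f (radialGaussMap (aleksandrovBody Ω f) u) := by
  obtain ⟨v, hv, huv⟩ := (hf.isGreatest_gauge u.coe_ne_zero).1
  rw [← hf.eq_radialGaussMap_of_eq_gauge hu hv huv]
  exact ⟨hv, hf.supportFn_eq_of_eq_gauge hv huv⟩

end Differentiable

end IsAleksandrovData

lemma gauge_aleksandrovBody_le_add (hf₁ : IsAleksandrovData Ω f₁) (hf₂ : IsAleksandrovData Ω f₂)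
    {κ : ℝ} (hκ : ∀ v ∈ Ω, |(f₁ v)⁻¹ - (f₂ v)⁻¹| ≤ κ) (u : Sphere n) :
    gauge (aleksandrovBody Ω f₁) u ≤ gauge (aleksandrovBody Ω f₂) u + κ := by
  obtain ⟨v, hv, huv⟩ := (hf₁.isGreatest_gauge u.coe_ne_zero).1
  calc gauge (aleksandrovBody Ω f₁) u = inner ℝ (u : EuclideanSpace ℝ (Fin n)) v * (f₂ v)⁻¹ +
        inner ℝ (u : EuclideanSpace ℝ (Fin n)) v * ((f₁ v)⁻¹ - (f₂ v)⁻¹) := by rw [← huv]; ring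
    _ ≤ gauge (aleksandrovBody Ω f₂) u + 1 * κ :=
        add_le_add (hf₂.inner_mul_inv_le_gauge u hv) ((le_abs_self _).trans ((abs_mul _ _).trans_le
          (mul_le_mul (u.abs_inner_le_one v) (hκ v hv) (abs_nonneg _) zero_le_one)))
    _ = gauge (aleksandrovBody Ω f₂) u + κ := by rw [one_mul]

lemma abs_gauge_aleksandrovBody_sub_le (hf₁ : IsAleksandrovData Ω f₁)
    (hf₂ : IsAleksandrovData Ω f₂) {κ : ℝ} (hκ : ∀ v ∈ Ω, |(f₁ v)⁻¹ - (f₂ v)⁻¹| ≤ κ)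
    (u : Sphere n) :
    |gauge (aleksandrovBody Ω f₁) u - gauge (aleksandrovBody Ω f₂) u| ≤ κ :=
  abs_sub_le_iff.2 ⟨sub_le_iff_le_add'.2 (gauge_aleksandrovBody_le_add hf₁ hf₂ hκ u),
    sub_le_iff_le_add'.2 (gauge_aleksandrovBody_le_add hf₂ hf₁
      (fun v hv => (abs_sub_comm _ _).trans_le (hκ v hv)) u)⟩

end AleksandrovBody

namespace IsAleksandrovData

variable {Ω : Set (Sphere n)} {f g : Sphere n → ℝ} {G : ℝ → Sphere n → ℝ} {ψ : ℝ → ℝ}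
  (hf : IsAleksandrovData Ω f) (hg : ContinuousOn g Ω)
  (hint : Integrable (curvatureIntegrand G ψ (aleksandrovBody Ω f)) (sphereMeasure n))
include hf hg

lemma measurable_indicator : Measurable (Ω.indicator g) := by
  classical
  rw [← piecewise_eq_indicator]
  exact hg.measurable_piecewise continuousOn_const hf.isCompact.measurableSet

include hint

lemma integrable_curvatureIntegrand_mul_indicator :
    Integrable (fun u => curvatureIntegrand G ψ (aleksandrovBody Ω f) u *
      Ω.indicator g (radialGaussMap (aleksandrovBody Ω f) u)) (sphereMeasure n) := by
  obtain ⟨B, hB⟩ := hf.isCompact.exists_bound_of_continuousOn hg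
  refine hf.isConvexBodyAroundZero.integrable_curvatureIntegrand_mul hint
    (hf.measurable_indicator hg) (B := max B 0) fun v => ?_
  by_cases hv : v ∈ Ω
  · rw [indicator_of_mem hv]
    exact (hB v hv).trans (le_max_left _ _)
  · rw [indicator_of_notMem hv, norm_zero]
    exact le_max_right _ _

lemma integrableOn_dualOrliczCurvatureMeasure :
    (dualOrliczCurvatureMeasure G ψ (aleksandrovBody Ω f)).IntegrableOn g Ω :=
  (VectorMeasure.integrable_indicator_iff hf.isCompact.measurableSet).1
    (hf.isConvexBodyAroundZero.integrable_dualOrliczCurvatureMeasure hint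
      (hf.measurable_indicator hg) (hf.integrable_curvatureIntegrand_mul_indicator hg hint))

lemma setIntegral_dualOrliczCurvatureMeasure :
    ∫ᵛ v in Ω, g v ∂•(dualOrliczCurvatureMeasure G ψ (aleksandrovBody Ω f)) =
      (n : ℝ)⁻¹ * ∫ u, curvatureIntegrand G ψ (aleksandrovBody Ω f) u *
        g (radialGaussMap (aleksandrovBody Ω f) u) ∂sphereMeasure n := by
  rw [← VectorMeasure.integral_indicator hf.isCompact.measurableSet,
    hf.isConvexBodyAroundZero.integral_dualOrliczCurvatureMeasure hint (hf.measurable_indicator hg)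
      (hf.integrable_curvatureIntegrand_mul_indicator hg hint)]
  congr 1
  refine integral_congr_ae ?_
  filter_upwards [hf.isConvexBodyAroundZero.ae_differentiableAt_gauge] with u hu
  rw [indicator_of_mem (hf.radialGaussMap_mem_and_supportFn_eq hu).1]

end IsAleksandrovData

/-! ### Variations of Aleksandrov bodies -/

lemma hasDerivAt_integral_of_eventually_norm_sub_le {α E : Type*} [MeasurableSpace α]
    {μ : Measure α} [NormedAddCommGroup E] [NormedSpace ℝ E] {F : ℝ → α → E} {F' : α → E}
    {bound : α → ℝ} {t₀ : ℝ} (hF : ∀ᶠ t in 𝓝 t₀, Integrable (F t) μ) (hbound : Integrable bound μ)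
    (hF_le : ∀ᶠ t in 𝓝 t₀, ∀ᵐ x ∂μ, ‖F t x - F t₀ x‖ ≤ bound x * |t - t₀|)
    (hF' : ∀ᵐ x ∂μ, HasDerivAt (fun t => F t x) (F' x) t₀) :
    HasDerivAt (fun t => ∫ x, F t x ∂μ) (∫ x, F' x ∂μ) t₀ := by
  rw [hasDerivAt_iff_tendsto_slope]
  refine (tendsto_integral_filter_of_dominated_convergence bound
    (F := fun t x => slope (fun t => F t x) t₀ t) ?_ ?_ hbound ?_).congr' ?_
  · filter_upwards [hF.filter_mono nhdsWithin_le_nhds] with t ht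
    exact ((ht.sub hF.self_of_nhds).smul (t - t₀)⁻¹).aestronglyMeasurable
  · filter_upwards [hF_le.filter_mono nhdsWithin_le_nhds, self_mem_nhdsWithin] with t ht hne
    filter_upwards [ht] with x hx
    rwa [slope_def_module, norm_smul, norm_inv, Real.norm_eq_abs,
      inv_mul_le_iff₀ (abs_pos.2 (sub_ne_zero.2 hne)), mul_comm]
  · filter_upwards [hF'] with x hx
    exact hasDerivAt_iff_tendsto_slope.1 hx
  · filter_upwards [hF.filter_mono nhdsWithin_le_nhds] with t ht
    simp only [slope_def_module, integral_smul, integral_sub ht hF.self_of_nhds]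

lemma exists_forall_abs_sub_le_mul_of_hasDerivAt {X : Type*} [TopologicalSpace X] [CompactSpace X]
    {F F' : ℝ → X → ℝ} {m M : ℝ} (hF : ∀ t ∈ Icc m M, ∀ x, HasDerivAt (F · x) (F' t x) t)
    (hF' : ContinuousOn (fun z : ℝ × X => F' z.1 z.2) (Icc m M ×ˢ univ)) :
    ∃ L, ∀ s ∈ Icc m M, ∀ t ∈ Icc m M, ∀ x, |F t x - F s x| ≤ L * |t - s| := by
  obtain ⟨L, hL⟩ := (isCompact_Icc.prod isCompact_univ).exists_bound_of_continuousOn hF'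
  exact ⟨L, fun s hs t ht x => (convex_Icc m M).norm_image_sub_le_of_norm_hasDerivWithin_le
    (fun r hr => (hF r hr x).hasDerivWithinAt) (fun r hr => hL (r, x) ⟨hr, mem_univ x⟩) hs ht⟩

lemma exists_forall_abs_comp_inv_sub_le {G : ℝ → Sphere n → ℝ}
    (hG_diff : ∀ t : ℝ, 0 < t → ∀ u, DifferentiableAt ℝ (fun s => G s u) t)
    (hG_t : ContinuousOn (fun p : ℝ × Sphere n => partialT G p.1 p.2) (Ioi 0 ×ˢ univ))
    {m : ℝ} (hm : 0 < m) (M : ℝ) :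
    ∃ L, ∀ s ∈ Icc m M, ∀ t ∈ Icc m M, ∀ u, |G t⁻¹ u - G s⁻¹ u| ≤ L * |t - s| := by
  have hpos {t : ℝ} (ht : t ∈ Icc m M) : 0 < t := hm.trans_le ht.1
  have hinv : ContinuousOn (fun z : ℝ × Sphere n => z.1⁻¹) (Icc m M ×ˢ univ) :=
    continuousOn_fst.inv₀ fun z hz => (hpos hz.1).ne'
  have hderiv : ContinuousOn (fun z : ℝ × Sphere n => partialT G z.1⁻¹ z.2 * -(z.1⁻¹ ^ 2))
      (Icc m M ×ˢ univ) :=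
    (hG_t.comp (hinv.prodMk continuousOn_snd) fun z hz =>
      ⟨inv_pos.2 (hpos hz.1), mem_univ z.2⟩).mul (hinv.pow 2).neg
  refine exists_forall_abs_sub_le_mul_of_hasDerivAt (F := fun t u => G t⁻¹ u)
    (F' := fun t u => partialT G t⁻¹ u * -(t⁻¹ ^ 2)) (fun t ht u => ?_) hderiv
  rw [inv_pow]
  exact (hG_diff _ (inv_pos.2 (hpos ht)) u).hasDerivAt.comp t (hasDerivAt_inv (hpos ht).ne')

section Variation

variable {Ω : Set (Sphere n)} {f : ℝ → Sphere n → ℝ} {p : Sphere n → ℝ}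

/-- `f ε`, for `ε` close to `0`, is a variation of the function `f 0` defining an Aleksandrov body
such that `1 / f ε` has derivative `p` at `ε = 0`, uniformly on `Ω`. The reciprocals are the natural
parameter, since the Minkowski functional of `[f]` depends linearly on `1 / f` before maximizing. -/
structure IsAleksandrovVariation (Ω : Set (Sphere n)) (f : ℝ → Sphere n → ℝ) (p : Sphere n → ℝ) :
    Prop where
  eventually_isAleksandrovData : ∀ᶠ ε in 𝓝 0, IsAleksandrovData Ω (f ε)
  hasUniformDerivAt : HasUniformDerivAt (fun ε v => (f ε v)⁻¹) p Ω 0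
  continuousOn : ContinuousOn p Ω

namespace IsAleksandrovVariation

variable (h : IsAleksandrovVariation Ω f p)
include h

lemma isAleksandrovData_zero : IsAleksandrovData Ω (f 0) :=
  h.eventually_isAleksandrovData.self_of_nhds

lemma isConvexBodyAroundZero_zero : IsConvexBodyAroundZero (aleksandrovBody Ω (f 0)) :=
  h.isAleksandrovData_zero.isConvexBodyAroundZero

lemma eventually_isConvexBodyAroundZero :
    ∀ᶠ ε in 𝓝 0, IsConvexBodyAroundZero (aleksandrovBody Ω (f ε)) :=
  h.eventually_isAleksandrovData.mono fun _ hε => hε.isConvexBodyAroundZero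

lemma hasDerivAt_gauge {u : Sphere n}
    (hu : DifferentiableAt ℝ (gauge (aleksandrovBody Ω (f 0))) (u : EuclideanSpace ℝ (Fin n))) :
    HasDerivAt (fun ε => gauge (aleksandrovBody Ω (f ε)) (u : EuclideanSpace ℝ (Fin n)))
      (inner ℝ (u : EuclideanSpace ℝ (Fin n)) (radialGaussMap (aleksandrovBody Ω (f 0)) u) *
        p (radialGaussMap (aleksandrovBody Ω (f 0)) u)) 0 := by
  have hf₀ := h.isAleksandrovData_zero
  have hinner : ContinuousOn (fun v : Sphere n => inner ℝ (u : EuclideanSpace ℝ (Fin n)) v) Ω := by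
    fun_prop
  exact (h.hasUniformDerivAt.bdd_mul fun v _ => u.abs_inner_le_one v).hasDerivAt_of_isGreatest_image
    hf₀.isCompact (hinner.mul hf₀.continuousOn_inv) (hinner.mul h.continuousOn)
    (h.eventually_isAleksandrovData.mono fun ε hε => hε.isGreatest_gauge u.coe_ne_zero)
    fun v hv huv => hf₀.eq_radialGaussMap_of_eq_gauge hu hv huv

lemma exists_eventually_abs_gauge_sub_le : ∃ C, ∀ᶠ ε in 𝓝 0, ∀ u : Sphere n,
    |gauge (aleksandrovBody Ω (f ε)) (u : EuclideanSpace ℝ (Fin n)) -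
      gauge (aleksandrovBody Ω (f 0)) u| ≤ C * |ε| := by
  obtain ⟨B, hB⟩ := h.isAleksandrovData_zero.isCompact.exists_bound_of_continuousOn h.continuousOn
  refine ⟨B + 1, ?_⟩
  filter_upwards [h.eventually_isAleksandrovData, h.hasUniformDerivAt.eventually_abs_sub_le hB]
    with ε hε hsub u
  rw [sub_zero] at hsub
  exact abs_gauge_aleksandrovBody_sub_le hε h.isAleksandrovData_zero hsub u

lemma exists_eventually_gauge_mem_Icc : ∃ m M, 0 < m ∧ ∀ᶠ ε in 𝓝 0, ∀ u : Sphere n,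
    gauge (aleksandrovBody Ω (f ε)) (u : EuclideanSpace ℝ (Fin n)) ∈ Icc m M := by
  have hK := h.isConvexBodyAroundZero_zero
  obtain ⟨m, hm, hlower⟩ := isCompact_univ.exists_forall_le' hK.continuous_gauge_coe.continuousOn
    fun u _ => hK.gauge_pos u.coe_ne_zero
  obtain ⟨M, hupper⟩ := isCompact_univ.exists_bound_of_continuousOn
    hK.continuous_gauge_coe.continuousOn
  obtain ⟨C, hC⟩ := h.exists_eventually_abs_gauge_sub_le
  have hsmall : ∀ᶠ ε in 𝓝 (0 : ℝ), C * |ε| < m / 2 :=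
    (show ContinuousAt (fun ε => C * |ε|) 0 by fun_prop).eventually_lt_const (by simpa using hm)
  refine ⟨m / 2, M + m / 2, half_pos hm, ?_⟩
  filter_upwards [hC, hsmall] with ε hε hεm u
  have hsub := abs_le.1 (hε u)
  have hle_m := hlower u (mem_univ u)
  have hle_M := (le_abs_self _).trans (hupper u (mem_univ u))
  exact ⟨by linarith, by linarith⟩

variable {G : ℝ → Sphere n → ℝ}
  (hG_diff : ∀ t : ℝ, 0 < t → ∀ u, DifferentiableAt ℝ (fun s => G s u) t)
include hG_diff

lemma hasDerivAt_comp_radialFn {u : Sphere n}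
    (hu : DifferentiableAt ℝ (gauge (aleksandrovBody Ω (f 0))) (u : EuclideanSpace ℝ (Fin n))) :
    HasDerivAt (fun ε => G (radialFn (aleksandrovBody Ω (f ε)) u) u)
      (radialFn (aleksandrovBody Ω (f 0)) u *
        partialT G (radialFn (aleksandrovBody Ω (f 0)) u) u *
        -(supportFn (aleksandrovBody Ω (f 0)) (radialGaussMap (aleksandrovBody Ω (f 0)) u) *
          p (radialGaussMap (aleksandrovBody Ω (f 0)) u))) 0 := by
  have hK := h.isConvexBodyAroundZero_zero
  have hgauge := (hK.gauge_pos u.coe_ne_zero).ne'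
  have hradial := ((h.hasDerivAt_gauge hu).fun_inv hgauge).congr_of_eventuallyEq
    (h.eventually_isConvexBodyAroundZero.mono fun ε hε => hε.radialFn_eq_inv_gauge u)
  refine ((hG_diff _ (hK.radialFn_pos u) u).hasDerivAt.comp (0 : ℝ) hradial).congr_deriv ?_
  rw [hK.mem_radialGaussImage_iff.1 (hK.radialGaussMap_mem u), partialT, hK.radialFn_eq_inv_gauge]
  field_simp

variable (hG_t : ContinuousOn (fun p : ℝ × Sphere n => partialT G p.1 p.2) (Ioi 0 ×ˢ univ))
include hG_t

lemma exists_eventually_abs_comp_radialFn_sub_le : ∃ C, ∀ᶠ ε in 𝓝 0, ∀ u,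
    |G (radialFn (aleksandrovBody Ω (f ε)) u) u - G (radialFn (aleksandrovBody Ω (f 0)) u) u| ≤
      C * |ε| := by
  obtain ⟨C, hC⟩ := h.exists_eventually_abs_gauge_sub_le
  obtain ⟨m, M, hm, hmem⟩ := h.exists_eventually_gauge_mem_Icc
  obtain ⟨L, hL⟩ := exists_forall_abs_comp_inv_sub_le hG_diff hG_t hm M
  refine ⟨|L| * C, ?_⟩
  filter_upwards [hC, hmem, h.eventually_isConvexBodyAroundZero] with ε hε hmem_ε hK u
  rw [hK.radialFn_eq_inv_gauge, h.isConvexBodyAroundZero_zero.radialFn_eq_inv_gauge]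
  calc _ ≤ L * |gauge (aleksandrovBody Ω (f ε)) (u : EuclideanSpace ℝ (Fin n)) -
        gauge (aleksandrovBody Ω (f 0)) u| := hL _ (hmem.self_of_nhds u) _ (hmem_ε u) u
    _ ≤ |L| * (C * |ε|) := by gcongr; exacts [le_abs_self L, hε u]
    _ = |L| * C * |ε| := by ring

theorem hasDerivAt_generalDualVolume
    (hG : ContinuousOn (fun p : ℝ × Sphere n => G p.1 p.2) (Ioi 0 ×ˢ univ)) :
    HasDerivAt (fun ε => generalDualVolume G (aleksandrovBody Ω (f ε)))
      (∫ u, radialFn (aleksandrovBody Ω (f 0)) u *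
        partialT G (radialFn (aleksandrovBody Ω (f 0)) u) u *
        -(supportFn (aleksandrovBody Ω (f 0)) (radialGaussMap (aleksandrovBody Ω (f 0)) u) *
          p (radialGaussMap (aleksandrovBody Ω (f 0)) u)) ∂sphereMeasure n) 0 := by
  obtain ⟨C, hC⟩ := h.exists_eventually_abs_comp_radialFn_sub_le hG_diff hG_t
  refine hasDerivAt_integral_of_eventually_norm_sub_le (bound := fun _ => C)
    (h.eventually_isConvexBodyAroundZero.mono fun ε hK =>
      integrable_sphereMeasure_of_continuous (hK.continuous_comp_radialFn hG))
    (integrable_const C) (hC.mono fun ε hε => Eventually.of_forall fun u => ?_)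
    (h.isConvexBodyAroundZero_zero.ae_differentiableAt_gauge.mono fun u hu =>
      h.hasDerivAt_comp_radialFn hG_diff hu)
  rw [sub_zero]
  exact hε u

end IsAleksandrovVariation

end Variation

/-! ### Orlicz perturbations -/

section Inverse

variable {φ : ℝ → ℝ} {s : Set ℝ}

lemma injOn_of_deriv_ne_zero (hs : s.OrdConnected) (hφ : ContinuousOn φ s)
    (hφ' : ∀ t ∈ s, deriv φ t ≠ 0) : InjOn φ s := by
  intro x hx y hy hxy
  by_contra hne
  wlog hlt : x < y generalizing x y
  · exact this hy hx hxy.symm (Ne.symm hne) ((le_of_not_gt hlt).lt_of_ne (Ne.symm hne))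
  obtain ⟨t, ht, ht'⟩ := exists_deriv_eq_zero hlt (hφ.mono (hs.out hx hy)) hxy
  exact hφ' t (hs.out hx hy (Ioo_subset_Icc_self ht)) ht'

variable {φ' t : ℝ} (hφ : HasStrictDerivAt φ φ' t) (hφ' : φ' ≠ 0) (hs : s ∈ 𝓝 t)
include hφ hφ' hs

lemma image_mem_nhds_of_hasStrictDerivAt : φ '' s ∈ 𝓝 (φ t) := by
  rw [← hφ.map_nhds_eq hφ']
  exact image_mem_map hs

lemma hasStrictDerivAt_invFunOn (hinj : InjOn φ s) :
    HasStrictDerivAt (Function.invFunOn φ s) φ'⁻¹ (φ t) :=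
  hφ.to_local_left_inverse hφ' (mem_of_superset hs fun _ hr => hinj.leftInvOn_invFunOn hr)

lemma hasStrictDerivAt_inv_invFunOn (hinj : InjOn φ s) (ht : t ≠ 0) :
    HasStrictDerivAt (fun y => (Function.invFunOn φ s y)⁻¹) (-φ'⁻¹ / t ^ 2) (φ t) := by
  have hinv : Function.invFunOn φ s (φ t) = t := hinj.leftInvOn_invFunOn (mem_of_mem_nhds hs)
  have hinv' : HasStrictDerivAt Inv.inv (-(t ^ 2)⁻¹) (Function.invFunOn φ s (φ t)) :=
    hinv.symm ▸ hasStrictDerivAt_inv ht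
  exact (hinv'.comp (φ t) (hasStrictDerivAt_invFunOn hφ hφ' hs hinj)).congr_deriv (by ring)

end Inverse

section OrliczPerturbation

variable {Ω : Set (Sphere n)} {φ : ℝ → ℝ} {h₀ g : Sphere n → ℝ} {G : ℝ → Sphere n → ℝ}

lemma orliczPerturbation_zero (hφ : InjOn φ (Ioi 0)) {u : Sphere n} (hu : 0 < h₀ u) :
    orliczPerturbation φ h₀ g 0 u = h₀ u := by
  rw [orliczPerturbation, zero_mul, add_zero]
  exact hφ.leftInvOn_invFunOn hu

lemma aleksandrovBody_orliczPerturbation_zero (hφ : InjOn φ (Ioi 0)) (hh₀ : ∀ v ∈ Ω, 0 < h₀ v) :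
    aleksandrovBody Ω (orliczPerturbation φ h₀ g 0) = aleksandrovBody Ω h₀ :=
  aleksandrovBody_congr fun v hv => orliczPerturbation_zero hφ (hh₀ v hv)

variable (hh₀ : IsAleksandrovData Ω h₀) (hg : ContinuousOn g Ω)
  (hφ : ContDiffOn ℝ 1 φ (Ioi 0)) (hφ' : ∀ t, 0 < t → deriv φ t ≠ 0)

include hφ in
lemma hasStrictDerivAt_of_contDiffOn_Ioi {t : ℝ} (ht : 0 < t) :
    HasStrictDerivAt φ (deriv φ t) t :=
  (hφ.contDiffAt (Ioi_mem_nhds ht)).hasStrictDerivAt one_ne_zero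

include hh₀ hg hφ hφ'

lemma eventually_forall_mem_image_Ioi :
    ∀ᶠ ε in 𝓝 (0 : ℝ), ∀ v ∈ Ω, φ (h₀ v) + ε * g v ∈ φ '' Ioi 0 :=
  eventually_forall_add_mul_mem hh₀.isCompact (hφ.continuousOn.comp hh₀.continuousOn hh₀.pos) hg
    fun v hv => image_mem_nhds_of_hasStrictDerivAt
      (hasStrictDerivAt_of_contDiffOn_Ioi hφ (hh₀.pos v hv)) (hφ' _ (hh₀.pos v hv))
      (Ioi_mem_nhds (hh₀.pos v hv))

lemma isAleksandrovData_orliczPerturbation {ε : ℝ}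
    (hε : ∀ v ∈ Ω, φ (h₀ v) + ε * g v ∈ φ '' Ioi 0) :
    IsAleksandrovData Ω (orliczPerturbation φ h₀ g ε) where
  isCompact := hh₀.isCompact
  not_subset_closedHemisphere := hh₀.not_subset_closedHemisphere
  pos v hv := Function.invFunOn_mem (hε v hv)
  continuousOn := by
    have hinj := injOn_of_deriv_ne_zero ordConnected_Ioi hφ.continuousOn hφ'
    have hinv : ContinuousOn (Function.invFunOn φ (Ioi 0)) (φ '' Ioi 0) := by
      rintro _ ⟨t, ht, rfl⟩
      exact (hasStrictDerivAt_invFunOn (hasStrictDerivAt_of_contDiffOn_Ioi hφ ht) (hφ' t ht)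
        (Ioi_mem_nhds ht) hinj).hasDerivAt.continuousAt.continuousWithinAt
    exact hinv.comp ((hφ.continuousOn.comp hh₀.continuousOn hh₀.pos).add (hg.const_mul ε)) hε

lemma isAleksandrovVariation_orliczPerturbation :
    IsAleksandrovVariation Ω (orliczPerturbation φ h₀ g)
      (fun v => g v * (-(deriv φ (h₀ v))⁻¹ / h₀ v ^ 2)) := by
  have hinj := injOn_of_deriv_ne_zero ordConnected_Ioi hφ.continuousOn hφ'
  have hderiv : ContinuousOn (fun v => -(deriv φ (h₀ v))⁻¹ / h₀ v ^ 2) Ω :=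
    (((hφ.continuousOn_deriv_of_isOpen isOpen_Ioi le_rfl).comp hh₀.continuousOn hh₀.pos).inv₀
      fun v hv => hφ' _ (hh₀.pos v hv)).neg.div (hh₀.continuousOn.pow 2)
      fun v hv => pow_ne_zero 2 (hh₀.pos v hv).ne'
  refine ⟨(eventually_forall_mem_image_Ioi hh₀ hg hφ hφ').mono fun ε =>
    isAleksandrovData_orliczPerturbation hh₀ hg hφ hφ', ?_, hg.mul hderiv⟩
  exact hasUniformDerivAt_comp_add_mul (Φ := fun y => (Function.invFunOn φ (Ioi 0) y)⁻¹)
    hh₀.isCompact (hφ.continuousOn.comp hh₀.continuousOn hh₀.pos) hg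
    (fun v hv => hasStrictDerivAt_inv_invFunOn
      (hasStrictDerivAt_of_contDiffOn_Ioi hφ (hh₀.pos v hv)) (hφ' _ (hh₀.pos v hv))
      (Ioi_mem_nhds (hh₀.pos v hv)) hinj (hh₀.pos v hv).ne') hderiv

theorem tendsto_generalDualVolume_orliczPerturbation
    (hG : ContinuousOn (fun p : ℝ × Sphere n => G p.1 p.2) (Ioi 0 ×ˢ univ))
    (hG_diff : ∀ t : ℝ, 0 < t → ∀ u, DifferentiableAt ℝ (fun s => G s u) t)
    (hG_t : ContinuousOn (fun p : ℝ × Sphere n => partialT G p.1 p.2) (Ioi 0 ×ˢ univ)) :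
    Tendsto (fun ε => (generalDualVolume G (aleksandrovBody Ω (orliczPerturbation φ h₀ g ε)) -
        generalDualVolume G (aleksandrovBody Ω h₀)) / ε) (𝓝[≠] 0)
      (𝓝 (∫ u, curvatureIntegrand G (fun t => t * deriv φ t) (aleksandrovBody Ω h₀) u *
        g (radialGaussMap (aleksandrovBody Ω h₀) u) ∂sphereMeasure n)) := by
  have hzero : aleksandrovBody Ω (orliczPerturbation φ h₀ g 0) = aleksandrovBody Ω h₀ :=
    aleksandrovBody_orliczPerturbation_zero
      (injOn_of_deriv_ne_zero ordConnected_Ioi hφ.continuousOn hφ') hh₀.pos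
  have hderiv := ((isAleksandrovVariation_orliczPerturbation hh₀ hg hφ hφ')
    |>.hasDerivAt_generalDualVolume hG_diff hG_t hG).tendsto_slope
  simp only [slope_fun_def_field, sub_zero, hzero] at hderiv
  refine hderiv.trans_eq (congrArg 𝓝 (integral_congr_ae ?_))
  filter_upwards [hh₀.isConvexBodyAroundZero.ae_differentiableAt_gauge] with u hu
  obtain ⟨hα, hsupport⟩ := hh₀.radialGaussMap_mem_and_supportFn_eq hu
  have hpos := hh₀.pos _ hα
  have hφ'_ne := hφ' _ hpos
  rw [curvatureIntegrand, hsupport]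
  field_simp

end OrliczPerturbation

end DualOrlicz

open DualOrlicz in
theorem mainTheorem2_general (n : ℕ) (hn : 1 ≤ n)
    (Ω : Set (Sphere n)) (hΩ : IsClosed Ω) (hΩ_hemi : ∀ v : Sphere n, ¬ Ω ⊆ closedHemisphere v)
    (g h₀ : Sphere n → ℝ) (hg : ContinuousOn g Ω) (hh₀ : ContinuousOn h₀ Ω)
    (hh₀_pos : ∀ u ∈ Ω, 0 < h₀ u)
    (φ : ℝ → ℝ) (hφ_smooth : ContDiffOn ℝ 1 φ (Ioi 0))
    (hφ_deriv : ∀ t : ℝ, 0 < t → deriv φ t ≠ 0)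
    (G : ℝ → Sphere n → ℝ)
    (hG : ContinuousOn (fun p : ℝ × Sphere n => G p.1 p.2) (Ioi 0 ×ˢ univ))
    (hG_diff : ∀ t : ℝ, 0 < t → ∀ u, DifferentiableAt ℝ (fun s => G s u) t)
    (hG_t : ContinuousOn (fun p : ℝ × Sphere n => partialT G p.1 p.2) (Ioi 0 ×ˢ univ)) :
    (∀ᶠ ε in 𝓝 (0 : ℝ),
      (∀ u ∈ Ω, φ (h₀ u) + ε * g u ∈ φ '' Ioi 0) ∧
      Integrable (fun u => G (radialFn (aleksandrovBody Ω (orliczPerturbation φ h₀ g ε)) u) u)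
        (sphereMeasure n)) ∧
    IsDualOrliczCurvatureMeasure G (fun t => t * deriv φ t) (aleksandrovBody Ω h₀)
      (dualOrliczCurvatureMeasure G (fun t => t * deriv φ t) (aleksandrovBody Ω h₀)) ∧
    (dualOrliczCurvatureMeasure G (fun t => t * deriv φ t)
      (aleksandrovBody Ω h₀)).IntegrableOn g Ω ∧
    Tendsto
      (fun ε : ℝ => (generalDualVolume G (aleksandrovBody Ω (orliczPerturbation φ h₀ g ε)) -
        generalDualVolume G (aleksandrovBody Ω h₀)) / ε)
      (𝓝[≠] 0)
      (𝓝 ((n : ℝ) * ∫ᵛ u in Ω, g u ∂•(dualOrliczCurvatureMeasure G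
        (fun t => t * deriv φ t) (aleksandrovBody Ω h₀)))) := by
  have hh₀' : IsAleksandrovData Ω h₀ := ⟨hΩ.isCompact, hΩ_hemi, hh₀, hh₀_pos⟩
  have hint : Integrable (curvatureIntegrand G (fun t => t * deriv φ t) (aleksandrovBody Ω h₀))
      (sphereMeasure n) :=
    hh₀'.isConvexBodyAroundZero.integrable_curvatureIntegrand hG_t
      (continuousOn_id.mul (hφ_smooth.continuousOn_deriv_of_isOpen isOpen_Ioi le_rfl))
      fun t ht => mul_ne_zero ht.ne' (hφ_deriv t ht)
  refine ⟨?_, hh₀'.isConvexBodyAroundZero.isDualOrliczCurvatureMeasure_dualOrliczCurvatureMeasure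
    hint, hh₀'.integrableOn_dualOrliczCurvatureMeasure hg hint, ?_⟩
  · filter_upwards [eventually_forall_mem_image_Ioi hh₀' hg hφ_smooth hφ_deriv] with ε hε
    have hK := (isAleksandrovData_orliczPerturbation hh₀' hg hφ_smooth hφ_deriv hε)
      |>.isConvexBodyAroundZero
    exact ⟨hε, integrable_sphereMeasure_of_continuous (hK.continuous_comp_radialFn hG)⟩
  · rw [hh₀'.setIntegral_dualOrliczCurvatureMeasure hg hint,
      mul_inv_cancel_left₀ (Nat.cast_ne_zero.2 (Nat.one_le_iff_ne_zero.1 hn))]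
    exact tendsto_generalDualVolume_orliczPerturbation hh₀' hg hφ_smooth hφ_deriv hG hG_diff hG_t

theorem mainTheorem2 (n : ℕ) (hn : 1 ≤ n)
    (Ω : Set (DualOrlicz.Sphere n)) (hΩ : IsClosed Ω)
    (hΩ_hemi : ∀ v : DualOrlicz.Sphere n, ¬ Ω ⊆ DualOrlicz.closedHemisphere v)
    (g h₀ : DualOrlicz.Sphere n → ℝ) (hg : ContinuousOn g Ω)
    (hh₀ : ContinuousOn h₀ Ω) (hh₀_pos : ∀ u ∈ Ω, 0 < h₀ u)
    (a : EReal) (φ : ℝ → ℝ) (hφ : DualOrlicz.ClassJ a φ)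
    (hφ_smooth : ContDiffOn ℝ 1 φ (Ioi 0)) (hφ_deriv : ∀ t : ℝ, 0 < t → deriv φ t ≠ 0)
    (G : ℝ → DualOrlicz.Sphere n → ℝ)
    (hG : ContinuousOn (fun p : ℝ × DualOrlicz.Sphere n => G p.1 p.2) (Ioi 0 ×ˢ univ))
    (hG_diff : ∀ t : ℝ, 0 < t → ∀ u, DifferentiableAt ℝ (fun s => G s u) t)
    (hG_t : ContinuousOn (fun p : ℝ × DualOrlicz.Sphere n => DualOrlicz.partialT G p.1 p.2)
      (Ioi 0 ×ˢ univ)) :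
    -- the objects in the formula are well defined
    (∀ᶠ ε in 𝓝 (0 : ℝ),
      (∀ u ∈ Ω, φ (h₀ u) + ε * g u ∈ φ '' Ioi 0) ∧
      Integrable (fun u => G (DualOrlicz.radialFn (DualOrlicz.aleksandrovBody Ω
        (DualOrlicz.orliczPerturbation φ h₀ g ε)) u) u) (DualOrlicz.sphereMeasure n)) ∧
    DualOrlicz.IsDualOrliczCurvatureMeasure G (fun t => t * deriv φ t)
      (DualOrlicz.aleksandrovBody Ω h₀)
      (DualOrlicz.dualOrliczCurvatureMeasure G (fun t => t * deriv φ t)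
        (DualOrlicz.aleksandrovBody Ω h₀)) ∧
    (DualOrlicz.dualOrliczCurvatureMeasure G (fun t => t * deriv φ t)
      (DualOrlicz.aleksandrovBody Ω h₀)).IntegrableOn g Ω ∧
    -- the variational formula
    Tendsto
      (fun ε : ℝ =>
        (DualOrlicz.generalDualVolume G
            (DualOrlicz.aleksandrovBody Ω (DualOrlicz.orliczPerturbation φ h₀ g ε)) -
          DualOrlicz.generalDualVolume G (DualOrlicz.aleksandrovBody Ω h₀)) / ε)
      (𝓝[≠] 0)
      (𝓝 ((n : ℝ) * ∫ᵛ u in Ω, g u ∂•(DualOrlicz.dualOrliczCurvatureMeasure G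
        (fun t => t * deriv φ t) (DualOrlicz.aleksandrovBody Ω h₀)))) :=
  mainTheorem2_general n hn Ω hΩ hΩ_hemi g h₀ hg hh₀ hh₀_pos φ hφ_smooth hφ_deriv G hG hG_diff hG_t
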